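/- Let $S\subset\mathbb R^3$ be a smooth embedded surface (without boundary). A regular patch in $S$ is a nonempty compact subset $P\subset S$ whose boundary $\Gamma$ relative to $S$ (its contour) is smooth, with $P$ lying locally on one side of $\Gamma$; let $A$ be the area of $P$, and let $\mathbf n$ be the exterior unit normal to $\Gamma$ within $S$, i.e. the unit vector tangent to $S$, orthogonal to $\Gamma$ and pointing out of $P$. For a unit normal $\mathbf N$ to $S$ at a point $p$, let $B^\alpha_\alpha=S^{\alpha\beta}B_{\alpha\beta}$ be the mean curvature of $S$ at $p$ consistent with $\mathbf N$, where in surface coordinates $u^1,u^2$ the vectors $\mathbf S_\alpha=\partial\mathbf R/\partial u^\alpha$ are the derivatives of the position vector $\mathbf R$, $(S^{\alpha\beta})$ is the inverse of the matrix $S_{\alpha\beta}=\mathbf S_\alpha\cdot\mathbf S_\beta$, and $B_{\alpha\beta}=\mathbf N\cdot\partial\mathbf S_\beta/\partial u^\alpha$. Every regular patch has $0<A<\infty$, its exterior normal $\mathbf n$ exists and is unique at every point of $\Gamma$, and $\mathbf n$ is integrable over $\Gamma$ with respect to arc length. For every point $p\in S$ and either unit normal $\mathbf N$ at $p$, $$\mathbf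 N B^\alpha_\alpha(p)=\lim \frac1A\int_\Gamma \mathbf n\,d\Gamma ,$$ where the limit is taken over regular patches $P\subset S$ that shrink to $p$: for every $\varepsilon>0$ there is a neighbourhood of $p$ such that, for every regular patch contained in it, the quantity on the right differs from $\mathbf N B^\alpha_\alpha(p)$ by less than $\varepsilon$. In particular, if $S$ is a minimal surface ($B^\alpha_\alpha=0$ everywhere on $S$), then $\int_\Gamma\mathbf n\,d\Gamma=0$ for the contour $\Gamma$ of every regular patch in $S$. -/

import Mathlib

open Set Filter Topology MeasureTheory
open scoped ContDiff

namespace SurfacePatch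

/-- Euclidean three-dimensional space. -/
abbrev E3 : Type := EuclideanSpace ℝ (Fin 3)

/-- The plane in which the surface coordinates live. -/
abbrev E2 : Type := EuclideanSpace ℝ (Fin 2)

/-- `φ`, restricted to the open set `U`, is a regular local parametrization of `S`: it is smooth,
an immersion, and a homeomorphism of `U` onto a relatively open subset of `S`
(the last field says that it is relatively open as a map into `S`). -/
structure IsLocalParam (S : Set E3) (φ : E2 → E3) (U : Set E2) : Prop where
  isOpen : IsOpen U
  smooth : ContDiffOn ℝ ∞ φ U
  immersion : ∀ u ∈ U, Function.Injective (fderiv ℝ φ u)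
  injOn : InjOn φ U
  open_image : ∀ W : Set E2, W ⊆ U → IsOpen W → ∃ V : Set E3, IsOpen V ∧ φ '' W = S ∩ V

/-- A smooth (embedded) surface in three-dimensional Euclidean space. -/
def IsSmoothSurface (S : Set E3) : Prop :=
  ∀ p ∈ S, ∃ (φ : E2 → E3) (U : Set E2) (u : E2), IsLocalParam S φ U ∧ u ∈ U ∧ φ u = p

/-! ### Covariant basis, metric, curvature tensor, mean curvature -/

/-- The coordinate vectors of the plane of surface coordinates. -/
noncomputable def coordVec (a : Fin 2) : E2 := EuclideanSpace.single a (1 : ℝ)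

/-- The covariant basis vector `S_a = ∂φ/∂u^a`. -/
noncomputable def covBasis (φ : E2 → E3) (a : Fin 2) (u : E2) : E3 :=
  fderiv ℝ φ u (coordVec a)

/-- The covariant metric tensor `S_ab = S_a · S_b`. -/
noncomputable def metricTensor (φ : E2 → E3) (u : E2) : Matrix (Fin 2) (Fin 2) ℝ :=
  Matrix.of fun a b => inner ℝ (covBasis φ a u) (covBasis φ b u)

/-- The curvature tensor `B_ab = N · ∂S_b/∂u^a` with respect to the normal vector `N`. -/
noncomputable def curvatureTensor (φ : E2 → E3) (u : E2) (N : E3) : Matrix (Fin 2) (Fin 2) ℝ :=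
  Matrix.of fun a b => inner ℝ N (fderiv ℝ (covBasis φ b) u (coordVec a))

/-- The mean curvature `B^a_a = S^{ab} B_ab` consistent with the normal vector `N`, where
`S^{ab}` is the inverse matrix of `S_ab` (the trace of the curvature tensor, without a factor
one half). -/
noncomputable def meanCurvature (φ : E2 → E3) (u : E2) (N : E3) : ℝ :=
  ∑ a, ∑ b, (metricTensor φ u)⁻¹ a b * curvatureTensor φ u N a b

/-- `N` is one of the two unit normals to the surface parametrized by `φ`, at the point `φ u`. -/
def IsUnitNormal (φ : E2 → E3) (u : E2) (N : E3) : Prop :=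
  ‖N‖ = 1 ∧ ∀ a, inner ℝ N (covBasis φ a u) = 0

/-- A minimal surface: a smooth surface whose mean curvature vanishes identically. -/
def IsMinimalSurface (S : Set E3) : Prop :=
  IsSmoothSurface S ∧
    ∀ (φ : E2 → E3) (U : Set E2), IsLocalParam S φ U → ∀ u ∈ U, ∀ N : E3,
      IsUnitNormal φ u N → meanCurvature φ u N = 0

/-! ### Patches and their contours -/

/-- The interior of `P` relative to the surface `S`. -/
def interiorIn (S P : Set E3) : Set E3 :=
  {x ∈ P | ∃ V : Set E3, IsOpen V ∧ x ∈ V ∧ S ∩ V ⊆ P}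

/-- The contour of a (compact) patch `P` in the surface `S`: its boundary relative to `S`. -/
def contour (S P : Set E3) : Set E3 := P \ interiorIn S P

/-- `φ` on `U` is a local parametrization of `S` adapted to the smooth contour of `P`: the part of
`P` in the parametrized region is the part `u⁰ ≤ 0`, and the contour is the coordinate line
`u⁰ = 0`. -/
def IsBoundaryParam (S P : Set E3) (φ : E2 → E3) (U : Set E2) : Prop :=
  IsLocalParam S φ U ∧ ∀ w ∈ U, (φ w ∈ P ↔ w 0 ≤ 0)

/-- A regular patch in the surface `S`: a nonempty compact subset of `S` whose contour is smooth,
with the patch lying locally on one side of its contour. -/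
structure IsRegularPatch (S P : Set E3) : Prop where
  subset : P ⊆ S
  nonempty : P.Nonempty
  isCompact : IsCompact P
  smooth_contour : ∀ x ∈ contour S P, ∃ (φ : E2 → E3) (U : Set E2) (u : E2),
    IsBoundaryParam S P φ U ∧ u ∈ U ∧ u 0 = 0 ∧ φ u = x

/-- `ν` is the exterior unit normal to the contour of `P` within `S` at the point `x`: it is a unit
vector, tangent to `S`, orthogonal to the contour, and it points out of `P`. In an adapted
parametrization the contour has the tangent vector `S_1`, and `S_0` points out of `P`. -/
def IsExteriorNormal (S P : Set E3) (x ν : E3) : Prop :=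
  ∃ (φ : E2 → E3) (U : Set E2) (u : E2),
    IsBoundaryParam S P φ U ∧ u ∈ U ∧ u 0 = 0 ∧ φ u = x ∧
      ‖ν‖ = 1 ∧ (∃ v : E2, ν = fderiv ℝ φ u v) ∧
      inner ℝ ν (covBasis φ 1 u) = 0 ∧ 0 < inner ℝ ν (covBasis φ 0 u)

/-- The exterior normal field `n` to the contour of `P` within `S`. -/
noncomputable def exteriorNormal (S P : Set E3) (x : E3) : E3 :=
  Classical.epsilon (IsExteriorNormal S P x)

/-- The area `A` of a subset of a surface: two-dimensional Euclidean Hausdorff measure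
(normalized so that it agrees with Lebesgue measure on planes). -/
noncomputable def area (P : Set E3) : ℝ := (μHE[2] P).toReal

/-- The contour integral `∫_Γ n dΓ`, with respect to arc length (one-dimensional Euclidean
Hausdorff measure). -/
noncomputable def normalIntegral (S P : Set E3) : E3 :=
  ∫ x in contour S P, exteriorNormal S P x ∂μHE[1]

/-- The filter of regular patches in `S` that shrink to the point `p`: a property of patches holds
eventually along it if, for some neighbourhood of `p`, all regular patches inside this
neighbourhood have the property. -/
def shrinkingPatches (S : Set E3) (p : E3) : Filter (Set E3) :=
  (𝓝 p).smallSets ⊓ 𝓟 {P | IsRegularPatch S P}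

end SurfacePatch

/-! The limit follows from an exact identity: over every regular patch, `∫_Γ n dΓ = ∫_P H dA`, where
`H = N B^a_a` is the mean curvature vector. It does not change with the choice of unit normal or of
chart. Since `H` is continuous, its mean over patches shrinking to `p` tends to `H(p)`, and on a
minimal surface the right side is zero.

The identity is a divergence theorem. In a chart let `J = √(det S_ab)` and `F^a = J S^{ab} S_b`
(`conormal`). Then `∂_a F^a = J H` (`div_conormal`): differentiating `F^a · S_c = J δ^a_c` shows
that the divergence has no tangential part, and pairing it with `N` leaves `J S^{ab} B_ab`. In a
chart where the patch is `u⁰ ≤ 0`, one has `F⁰ = |S_1| n` along the contour. So integrating the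
divergence over the half plane gives the flux of `F⁰` through the line `u⁰ = 0`, which is the
integral of `n` against arc length.

The localization uses cutoffs `χ`: the divergence of `χ F^a` is `J (χ H + ∇χ)` with the tangential
gradient (`local_stokes`). Summing over a finite partition of unity, the gradients cancel and `H`
remains (`stokes`). Area and length are Hausdorff measures, so the passage between chart and surface
rests on an area formula for injective C¹ immersions. -/

namespace SurfacePatch

/-! ### Area formula for Hausdorff measure under injective C¹ immersions. -/

section AreaFormula

open Module Measure
open scoped NNReal ENNReal

/-- The hypothesis makes `g x ↦ f x` a well-defined `k`-Lipschitz map on `g '' s`, even where `g` is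
not injective, and such a map enlarges `d`-dimensional measure by at most `k ^ d`. -/
theorem euclideanHausdorffMeasure_image_le_of_edist_le {X Y Z : Type*} [EMetricSpace Y]
    [MeasurableSpace Y] [BorelSpace Y] [EMetricSpace Z] [MeasurableSpace Z] [BorelSpace Z]
    {f : X → Y} {g : X → Z} {s : Set X} {k : ℝ≥0} (d : ℕ)
    (h : ∀ x ∈ s, ∀ y ∈ s, edist (f x) (f y) ≤ k * edist (g x) (g y)) :
    μHE[d] (f '' s) ≤ (k : ℝ≥0∞) ^ d * μHE[d] (g '' s) := by
  rcases s.eq_empty_or_nonempty with rfl | ⟨x₀, hx₀⟩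
  · simp
  have : Nonempty X := ⟨x₀⟩
  set i : Z → X := Function.invFunOn g s
  have hi : ∀ z ∈ g '' s, i z ∈ s ∧ g (i z) = z := fun z hz =>
    ⟨Function.invFunOn_mem hz, Function.invFunOn_eq hz⟩
  have hL : LipschitzOnWith k (f ∘ i) (g '' s) := by
    intro z hz w hw
    have := h _ (hi z hz).1 _ (hi w hw).1
    rwa [(hi z hz).2, (hi w hw).2] at this
  have himg : (f ∘ i) '' (g '' s) = f '' s := by
    rw [image_image]
    refine image_congr fun x hx => ?_
    have hx' := hi (g x) (mem_image_of_mem g hx)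
    have := h _ hx'.1 _ hx
    rw [hx'.2, edist_self, mul_zero, nonpos_iff_eq_zero] at this
    exact edist_eq_zero.1 this
  have := hL.hausdorffMeasure_image_le (d := (d : ℝ)) (by positivity)
  rw [himg] at this
  simp_rw [euclideanHausdorffMeasure_def, Measure.smul_apply, nnreal_smul_coe_apply]
  calc _ ≤ _ := mul_le_mul_right this _
    _ = _ := by rw [ENNReal.rpow_natCast]; exact mul_left_comm _ _ _

variable {E F : Type*} [NormedAddCommGroup E] [InnerProductSpace ℝ E] [FiniteDimensional ℝ E]
  [NormedAddCommGroup F] [InnerProductSpace ℝ F]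

theorem continuous_normDet :
    Continuous fun L : E →L[ℝ] F => L.toLinearMap.normDet := by
  have h : (fun L : E →L[ℝ] F => L.toLinearMap.normDet) = fun L : E →L[ℝ] F =>
      √(Matrix.gram ℝ (fun i => L (stdOrthonormalBasis ℝ E i))).det := by
    funext L
    have := L.toLinearMap.normDet_sq_eq_det_gram (stdOrthonormalBasis ℝ E)
    simp only [ContinuousLinearMap.coe_coe] at this
    rw [← this]
    simp [Real.sqrt_sq L.toLinearMap.normDet_nonneg]
  rw [h]
  refine Real.continuous_sqrt.comp (Continuous.matrix_det ?_)
  refine continuous_matrix fun i j => ?_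
  simp only [Matrix.gram_apply]
  fun_prop

variable {f : E → F} {U s : Set E}

theorem continuousOn_normDet_fderiv (hU : IsOpen U) (hf : ContDiffOn ℝ 1 f U) :
    ContinuousOn (fun x => (fderiv ℝ f x).toLinearMap.normDet) U :=
  continuous_normDet.comp_continuousOn (hf.continuousOn_fderiv_of_isOpen hU le_rfl)

theorem normDet_pos {L : E →L[ℝ] F} (hL : Function.Injective L) : 0 < L.toLinearMap.normDet :=
  lt_of_le_of_ne L.toLinearMap.normDet_nonneg
    (Ne.symm ((L.toLinearMap.normDet_ne_zero_tfae.out 0 4 rfl rfl).2 hL))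

variable [MeasurableSpace E] [BorelSpace E]

theorem measurable_normDet_fderiv [SecondCountableTopology F] [CompleteSpace F] :
    Measurable fun x => (fderiv ℝ f x).toLinearMap.normDet :=
  continuous_normDet.measurable.comp (measurable_fderiv ℝ f)

variable [MeasurableSpace F] [BorelSpace F]

/-- Strict differentiability and the lower bound on the injective `L` make `f` and `L` bi-Lipschitz
to each other near `x`, with constant `k` both ways. For the linear map `L` the measure of the image
is exactly `normDet` times volume. -/
theorem exists_nhds_euclideanHausdorffMeasure_image_comparable {f : E → F} {L : E →L[ℝ] F} {x : E}
    (hf : HasStrictFDerivAt f L x) (hL : Function.Injective L) {k : ℝ≥0} (hk : 1 < k) :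
    ∃ W ∈ 𝓝 x, ∀ s ⊆ W,
      μHE[finrank ℝ E] (f '' s) ≤
        (k : ℝ≥0∞) ^ finrank ℝ E * (ENNReal.ofReal L.toLinearMap.normDet * volume s) ∧
      ENNReal.ofReal L.toLinearMap.normDet * volume s ≤
        (k : ℝ≥0∞) ^ finrank ℝ E * μHE[finrank ℝ E] (f '' s) := by
  obtain ⟨K, hK0, hK⟩ := L.toLinearMap.exists_antilipschitzWith (LinearMap.ker_eq_bot.2 hL)
  have hKv : ∀ v, ‖v‖ ≤ K * ‖L v‖ := fun v => by
    simpa using hK.le_mul_dist v 0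
  have hk' : (1 : ℝ) < k := by exact_mod_cast hk
  have hK0' : (0 : ℝ) < K := by exact_mod_cast hK0
  -- This value gives both `1 + δ ≤ k` and `1 - δ = 1 / k`, the two bounds needed below.
  set δ : ℝ := 1 - (k : ℝ)⁻¹ with hδ
  have hδ0 : 0 < δ := by
    have := inv_lt_one_of_one_lt₀ hk'
    linarith
  -- Dividing by the antilipschitz constant `K` turns the error into one relative to `‖L y - L z‖`.
  have hb := hf.isLittleO.def (c := δ / K) (by positivity)
  obtain ⟨W, hW, hWs⟩ := mem_nhds_prod_iff.1 hb
  obtain ⟨W', hW', hWs'⟩ := hWs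
  have key : ∀ y ∈ W ∩ W', ∀ z ∈ W ∩ W', ‖f y - f z - L (y - z)‖ ≤ δ * ‖L y - L z‖ := by
    intro y hy z hz
    have h1 : ‖f y - f z - L (y - z)‖ ≤ δ / K * ‖y - z‖ := hWs' (mk_mem_prod hy.1 hz.2)
    have h2 := hKv (y - z)
    rw [map_sub] at h2
    calc _ ≤ _ := h1
      _ ≤ δ / K * (K * ‖L y - L z‖) := by gcongr
      _ = _ := by field_simp
  have hkk : (k : ℝ)⁻¹ * k = 1 := inv_mul_cancel₀ (by positivity)
  refine ⟨W ∩ W', inter_mem hW hW', fun s hs => ?_⟩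
  rw [← L.toLinearMap.euclideanHausdorffMeasure_image_eq_normDet_mul_volume]
  constructor
  · refine euclideanHausdorffMeasure_image_le_of_edist_le _ fun y hy z hz => ?_
    rw [edist_nndist, edist_nndist, ← ENNReal.coe_mul, ENNReal.coe_le_coe, ← NNReal.coe_le_coe]
    push_cast
    rw [dist_eq_norm, dist_eq_norm]
    have h := key y (hs hy) z (hs hz)
    have h3 : ‖f y - f z‖ ≤ ‖f y - f z - L (y - z)‖ + ‖L y - L z‖ := by
      rw [map_sub]; exact norm_le_norm_sub_add _ _
    have h4 : δ ≤ k - 1 := by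
      rw [hδ]
      nlinarith [inv_lt_one_of_one_lt₀ hk']
    have h5 := norm_nonneg (L y - L z)
    show _ ≤ (k : ℝ) * ‖L y - L z‖
    nlinarith
  · refine euclideanHausdorffMeasure_image_le_of_edist_le _ fun y hy z hz => ?_
    rw [edist_nndist, edist_nndist, ← ENNReal.coe_mul, ENNReal.coe_le_coe, ← NNReal.coe_le_coe]
    push_cast
    rw [dist_eq_norm, dist_eq_norm]
    have h := key y (hs hy) z (hs hz)
    have h3 : ‖L y - L z‖ ≤ ‖f y - f z - L (y - z)‖ + ‖f y - f z‖ := by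
      rw [map_sub, ← norm_neg (f y - f z - _)]
      have : L y - L z = -(f y - f z - (L y - L z)) + (f y - f z) := by abel
      conv_lhs => rw [this]
      exact norm_add_le _ _
    show ‖L y - L z‖ ≤ (k : ℝ) * ‖f y - f z‖
    have h4 : (k : ℝ)⁻¹ * ‖L y - L z‖ ≤ ‖f y - f z‖ := by rw [hδ] at h; linarith
    calc ‖L y - L z‖ = k * ((k : ℝ)⁻¹ * ‖L y - L z‖) := by
          rw [← mul_assoc, mul_comm (k : ℝ), hkk, one_mul]
      _ ≤ _ := by gcongr

/-- The extra factor `k` in the exponent pays for replacing the Jacobian at nearby points by its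
value at `x`. -/
theorem exists_nhds_euclideanHausdorffMeasure_image_comparable_lintegral (hU : IsOpen U)
    (hf : ContDiffOn ℝ 1 f U) (hinj : ∀ x ∈ U, Function.Injective (fderiv ℝ f x))
    {x : E} (hx : x ∈ U) {k : ℝ≥0} (hk : 1 < k) :
    ∃ W ∈ 𝓝 x, ∀ s ⊆ W, MeasurableSet s →
      μHE[finrank ℝ E] (f '' s) ≤ (k : ℝ≥0∞) ^ (finrank ℝ E + 1) *
        ∫⁻ y in s, ENNReal.ofReal (fderiv ℝ f y).toLinearMap.normDet ∧
      ∫⁻ y in s, ENNReal.ofReal (fderiv ℝ f y).toLinearMap.normDet ≤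
        (k : ℝ≥0∞) ^ (finrank ℝ E + 1) * μHE[finrank ℝ E] (f '' s) := by
  have hk' : (1 : ℝ) < k := by exact_mod_cast hk
  set D := (fderiv ℝ f x).toLinearMap.normDet with hD
  have hD0 : 0 < D := normDet_pos (hinj x hx)
  have hst : HasStrictFDerivAt f (fderiv ℝ f x) x :=
    ((hf.contDiffAt (hU.mem_nhds hx)).hasStrictFDerivAt one_ne_zero)
  obtain ⟨W, hW, hWs⟩ := exists_nhds_euclideanHausdorffMeasure_image_comparable hst (hinj x hx) hk
  have hc : ContinuousAt (fun y => (fderiv ℝ f y).toLinearMap.normDet) x :=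
    (continuousOn_normDet_fderiv hU hf).continuousAt (hU.mem_nhds hx)
  have h1 : ∀ᶠ y in 𝓝 x, (fderiv ℝ f y).toLinearMap.normDet < k * D :=
    hc.eventually_lt_const (show D < k * D by nlinarith)
  have h2 : ∀ᶠ y in 𝓝 x, (k : ℝ)⁻¹ * D < (fderiv ℝ f y).toLinearMap.normDet :=
    hc.eventually_const_lt (show (k : ℝ)⁻¹ * D < D by nlinarith [inv_lt_one_of_one_lt₀ hk'])
  refine ⟨W ∩ {y | _}, inter_mem hW (h1.and h2), fun s hs hms => ?_⟩
  obtain ⟨ha, hb⟩ := hWs s (hs.trans inter_subset_left)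
  rw [← hD] at ha hb
  have hu : ∫⁻ y in s, ENNReal.ofReal (fderiv ℝ f y).toLinearMap.normDet ≤
      k * (ENNReal.ofReal D * volume s) := by
    rw [← mul_assoc, ← setLIntegral_const]
    refine setLIntegral_mono measurable_const fun y hy => ?_
    rw [← ENNReal.ofReal_coe_nnreal, ← ENNReal.ofReal_mul (by positivity)]
    exact ENNReal.ofReal_le_ofReal (hs hy).2.1.le
  have hl : ENNReal.ofReal D * volume s ≤
      k * ∫⁻ y in s, ENNReal.ofReal (fderiv ℝ f y).toLinearMap.normDet := by
    rw [← lintegral_const_mul' _ _ ENNReal.coe_ne_top, ← setLIntegral_const]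
    refine setLIntegral_mono' hms fun y hy => ?_
    rw [← ENNReal.ofReal_coe_nnreal, ← ENNReal.ofReal_mul (by positivity)]
    refine ENNReal.ofReal_le_ofReal ?_
    have := (hs hy).2.2.le
    calc D = k * ((k : ℝ)⁻¹ * D) := by field_simp
      _ ≤ _ := by gcongr
  constructor
  · calc _ ≤ _ := ha
      _ ≤ _ := mul_le_mul_right hl _
      _ = _ := by rw [pow_succ, mul_assoc]
  · calc _ ≤ _ := hu
      _ ≤ _ := mul_le_mul_right hb _
      _ = _ := by rw [pow_succ', mul_assoc]

/-- A countable cover by neighbourhoods of comparison, made disjoint, gives both inequalities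
globally with the factor `k ^ (finrank + 1)`; then `k` decreases to 1. -/
theorem euclideanHausdorffMeasure_image_eq_lintegral (hU : IsOpen U)
    (hf : ContDiffOn ℝ 1 f U) (hinj : ∀ x ∈ U, Function.Injective (fderiv ℝ f x))
    (hfi : InjOn f U) (hsU : s ⊆ U) (hs : MeasurableSet s) :
    μHE[finrank ℝ E] (f '' s) =
      ∫⁻ y in s, ENNReal.ofReal (fderiv ℝ f y).toLinearMap.normDet := by
  have main : ∀ k : ℝ≥0, 1 < k →
      μHE[finrank ℝ E] (f '' s) ≤ (k : ℝ≥0∞) ^ (finrank ℝ E + 1) *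
        ∫⁻ y in s, ENNReal.ofReal (fderiv ℝ f y).toLinearMap.normDet ∧
      ∫⁻ y in s, ENNReal.ofReal (fderiv ℝ f y).toLinearMap.normDet ≤
        (k : ℝ≥0∞) ^ (finrank ℝ E + 1) * μHE[finrank ℝ E] (f '' s) := by
    intro k hk
    rcases s.eq_empty_or_nonempty with rfl | hne
    · simp
    choose! W hW hWs using fun x (hx : x ∈ U) =>
      exists_nhds_euclideanHausdorffMeasure_image_comparable_lintegral hU hf hinj hx hk
    obtain ⟨t, hts, htc, hcov⟩ := TopologicalSpace.countable_cover_nhdsWithin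
      (f := fun x => interior (W x)) (s := s)
      fun x hx => mem_nhdsWithin_of_mem_nhds (interior_mem_nhds.2 (hW x (hsU hx)))
    have htne : t.Nonempty := by
      obtain ⟨x, hx⟩ := hne
      obtain ⟨y, hy, -⟩ := mem_iUnion₂.1 (hcov hx)
      exact ⟨y, hy⟩
    obtain ⟨e, he⟩ := htc.exists_eq_range htne
    have hte : ∀ n, e n ∈ U := fun n => hsU (hts (he ▸ mem_range_self n))
    set A : ℕ → Set E := fun n => s ∩ disjointed (fun n => interior (W (e n))) n with hA
    have hAm : ∀ n, MeasurableSet (A n) := fun n =>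
      hs.inter (MeasurableSet.disjointed (fun n => isOpen_interior.measurableSet) n)
    have hAd : Pairwise (Function.onFun Disjoint A) := fun i j hij =>
      (disjoint_disjointed _ hij).mono inter_subset_right inter_subset_right
    have hAs : s = ⋃ n, A n := by
      rw [hA, ← inter_iUnion, iUnion_disjointed]
      refine (inter_eq_left.2 ?_).symm
      refine hcov.trans ?_
      rw [he, biUnion_range]
    have hAU : ∀ n, A n ⊆ U := fun n => inter_subset_left.trans hsU
    have hAW : ∀ n, A n ⊆ W (e n) := fun n =>
      inter_subset_right.trans ((disjointed_subset _ n).trans interior_subset)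
    -- Injectivity of `f` keeps the images of the pieces disjoint, and a continuous injective map
    -- sends measurable sets to measurable sets.
    have e1 : μHE[finrank ℝ E] (f '' s) = ∑' n, μHE[finrank ℝ E] (f '' (A n)) := by
      conv_lhs => rw [hAs]
      rw [image_iUnion, measure_iUnion]
      · intro i j hij
        refine disjoint_left.2 ?_
        rintro _ ⟨a, ha, rfl⟩ ⟨b, hb, hab⟩
        exact disjoint_left.1 (hAd hij) ha (hfi (hAU j hb) (hAU i ha) hab ▸ hb)
      · exact fun n => (hAm n).image_of_continuousOn_injOn (hf.continuousOn.mono (hAU n))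
          (hfi.mono (hAU n))
    have e2 : ∫⁻ y in s, ENNReal.ofReal (fderiv ℝ f y).toLinearMap.normDet =
        ∑' n, ∫⁻ y in A n, ENNReal.ofReal (fderiv ℝ f y).toLinearMap.normDet := by
      conv_lhs => rw [hAs]
      rw [lintegral_iUnion hAm hAd]
    rw [e1, e2, ← ENNReal.tsum_mul_left, ← ENNReal.tsum_mul_left]
    exact ⟨ENNReal.tsum_le_tsum fun n => (hWs _ (hte n) _ (hAW n) (hAm n)).1,
      ENNReal.tsum_le_tsum fun n => (hWs _ (hte n) _ (hAW n) (hAm n)).2⟩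
  have lim : ∀ a : ℝ≥0∞, Tendsto (fun k : ℝ≥0 => (k : ℝ≥0∞) ^ (finrank ℝ E + 1) * a)
      (𝓝[>] 1) (𝓝 a) := by
    intro a
    have h1 : Tendsto (fun k : ℝ≥0 => (k : ℝ≥0∞) ^ (finrank ℝ E + 1)) (𝓝[>] 1) (𝓝 1) := by
      have : Tendsto (fun k : ℝ≥0 => ((k ^ (finrank ℝ E + 1) : ℝ≥0) : ℝ≥0∞)) (𝓝 1) (𝓝 1) := by
        rw [← ENNReal.coe_one, ENNReal.tendsto_coe]
        exact (continuous_pow _).tendsto' _ _ (one_pow _)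
      simpa using this.mono_left nhdsWithin_le_nhds
    simpa using ENNReal.Tendsto.mul_const h1 (Or.inl one_ne_zero)
  refine le_antisymm (ge_of_tendsto (lim _) ?_) (ge_of_tendsto (lim _) ?_)
  · exact eventually_nhdsWithin_of_forall fun k hk => (main k hk).1
  · exact eventually_nhdsWithin_of_forall fun k hk => (main k hk).2

/-- The area formula as an identity of measures. As `f` restricts to a measurable embedding, it
transfers integrals and integrability of arbitrary functions, with no measurability assumption on
them. -/
theorem map_withDensity_normDet_fderiv (hU : IsOpen U)
    (hf : ContDiffOn ℝ 1 f U) (hinj : ∀ x ∈ U, Function.Injective (fderiv ℝ f x))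
    (hfi : InjOn f U) (hsU : s ⊆ U) (hs : MeasurableSet s) :
    Measure.map (s.domRestrict f) (comap (↑) (volume.withDensity fun x =>
        ENNReal.ofReal (fderiv ℝ f x).toLinearMap.normDet)) =
      μHE[finrank ℝ E].restrict (f '' s) := by
  have hme : MeasurableEmbedding (s.domRestrict f) :=
    (hf.continuousOn.mono hsU).measurableEmbedding hs (hfi.mono hsU)
  ext t ht
  rw [hme.map_apply, (MeasurableEmbedding.subtype_coe hs).comap_apply, Measure.restrict_apply ht]
  have h1 : Subtype.val '' (s.domRestrict f ⁻¹' t) = s ∩ (f ⁻¹' t) := by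
    ext x; simp [Set.domRestrict_apply, and_comm]
  have h2 : MeasurableSet (s ∩ f ⁻¹' t) := by
    rw [← h1]; exact (MeasurableEmbedding.subtype_coe hs).measurableSet_image' (hme.measurable ht)
  rw [h1, withDensity_apply _ h2, ← euclideanHausdorffMeasure_image_eq_lintegral hU hf hinj hfi
    (inter_subset_left.trans hsU) h2, image_inter_preimage, inter_comm]

theorem integrableOn_image_iff_integrableOn_normDet_fderiv_smul [FiniteDimensional ℝ F]
    {G : Type*} [NormedAddCommGroup G] [NormedSpace ℝ G] (hU : IsOpen U)
    (hf : ContDiffOn ℝ 1 f U) (hinj : ∀ x ∈ U, Function.Injective (fderiv ℝ f x))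
    (hfi : InjOn f U) (hsU : s ⊆ U) (hs : MeasurableSet s) (g : F → G) :
    IntegrableOn g (f '' s) μHE[finrank ℝ E] ↔
      IntegrableOn (fun x => (fderiv ℝ f x).toLinearMap.normDet • g (f x)) s := by
  have hme : MeasurableEmbedding (s.domRestrict f) :=
    (hf.continuousOn.mono hsU).measurableEmbedding hs (hfi.mono hsU)
  rw [IntegrableOn, ← map_withDensity_normDet_fderiv hU hf hinj hfi hsU hs,
    hme.integrable_map_iff]
  simp only [Set.domRestrict_eq, ← Function.comp_assoc, ENNReal.ofReal]
  rw [← (MeasurableEmbedding.subtype_coe hs).integrable_map_iff, map_comap_subtype_coe hs,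
    restrict_withDensity hs, integrable_withDensity_iff_integrable_coe_smul₀]
  · simp_rw [IntegrableOn, Real.coe_toNNReal _ (LinearMap.normDet_nonneg _), Function.comp_apply]
  · exact measurable_normDet_fderiv.real_toNNReal.aemeasurable

theorem integral_image_eq_integral_normDet_fderiv_smul [FiniteDimensional ℝ F]
    {G : Type*} [NormedAddCommGroup G] [NormedSpace ℝ G] (hU : IsOpen U)
    (hf : ContDiffOn ℝ 1 f U) (hinj : ∀ x ∈ U, Function.Injective (fderiv ℝ f x))
    (hfi : InjOn f U) (hsU : s ⊆ U) (hs : MeasurableSet s) (g : F → G) :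
    ∫ x in f '' s, g x ∂μHE[finrank ℝ E] =
      ∫ x in s, (fderiv ℝ f x).toLinearMap.normDet • g (f x) := by
  have hme : MeasurableEmbedding (s.domRestrict f) :=
    (hf.continuousOn.mono hsU).measurableEmbedding hs (hfi.mono hsU)
  rw [← map_withDensity_normDet_fderiv hU hf hinj hfi hsU hs, hme.integral_map]
  simp only [Set.domRestrict_apply, ← Function.comp_apply (f := g), ENNReal.ofReal]
  rw [← (MeasurableEmbedding.subtype_coe hs).integral_map, map_comap_subtype_coe hs,
    setIntegral_withDensity_eq_setIntegral_smul₀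
      (measurable_normDet_fderiv.real_toNNReal.aemeasurable) _ hs]
  congr with x
  rw [NNReal.smul_def, Real.coe_toNNReal _ (LinearMap.normDet_nonneg _)]

end AreaFormula

/-! ### Change of chart, unit normals, and the mean curvature vector. -/

section Charts

variable {S : Set E3} {φ ψ : E2 → E3} {U V : Set E2} {u w : E2}

theorem one_add_one_le_infty : (1 : WithTop ℕ∞) + 1 ≤ ∞ := by
  rw [one_add_one_eq_two]; exact WithTop.coe_le_coe.2 (le_top (a := (2 : ℕ∞)))

theorem eq_sum_coordVec (v : E2) : v = v 0 • coordVec 0 + v 1 • coordVec 1 := by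
  ext i
  fin_cases i <;> simp [coordVec]

@[simp] theorem coordVec_zero_zero : coordVec 0 0 = 1 := by simp [coordVec]
@[simp] theorem coordVec_one_zero : coordVec 1 0 = 0 := by simp [coordVec]
@[simp] theorem coordVec_one_one : coordVec 1 1 = 1 := by simp [coordVec]

theorem IsLocalParam.mono (h : IsLocalParam S φ U) (hV : IsOpen V) (hVU : V ⊆ U) :
    IsLocalParam S φ V where
  isOpen := hV
  smooth := h.smooth.mono hVU
  immersion := fun u hu => h.immersion u (hVU hu)
  injOn := h.injOn.mono hVU
  open_image := fun W hW hWo => h.open_image W (hW.trans hVU) hWo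

theorem IsLocalParam.translate (h : IsLocalParam S φ U) (c : E2) :
    IsLocalParam S (fun u => φ (u + c)) ((fun u => u + c) ⁻¹' U) where
  isOpen := h.isOpen.preimage (by fun_prop)
  smooth := h.smooth.comp (by fun_prop) (mapsTo_preimage _ _)
  immersion := fun u hu => by
    rw [fderiv_comp_add_right]
    exact h.immersion _ hu
  injOn := fun a ha b hb hab => add_right_cancel (h.injOn ha hb hab)
  open_image := fun W hW hWo => by
    obtain ⟨O, hO, hOW⟩ := h.open_image ((fun u => u + c) '' W) (image_subset_iff.2 hW)
      (by simpa using (Homeomorph.addRight c).isOpenMap W hWo)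
    exact ⟨O, hO, by rw [← hOW, image_image]⟩

theorem IsLocalParam.mapsTo (h : IsLocalParam S φ U) : MapsTo φ U S := by
  obtain ⟨O, -, hO⟩ := h.open_image U subset_rfl h.isOpen
  exact fun u hu => (hO.subset (mem_image_of_mem φ hu)).1

theorem IsLocalParam.contDiffAt (h : IsLocalParam S φ U) (hu : u ∈ U) : ContDiffAt ℝ ∞ φ u :=
  h.smooth.contDiffAt (h.isOpen.mem_nhds hu)

theorem IsLocalParam.differentiableAt (h : IsLocalParam S φ U) (hu : u ∈ U) :
    DifferentiableAt ℝ φ u :=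
  (h.contDiffAt hu).differentiableAt (by simp)

/-- With `G` a linear left inverse of `dψ_w`, the map `G ∘ ψ` is a local diffeomorphism of the
plane, and `τ = (G ∘ ψ)⁻¹ ∘ G ∘ φ`. -/
theorem IsLocalParam.exists_transition (hφ : IsLocalParam S φ U) (hψ : IsLocalParam S ψ V)
    (hu : u ∈ U) (hw : w ∈ V) (huw : φ u = ψ w) :
    ∃ τ : E2 → E2, ContDiffAt ℝ ∞ τ u ∧ τ u = w ∧ ∀ᶠ a in 𝓝 u, τ a ∈ V ∧ φ a = ψ (τ a) := by
  obtain ⟨G, hG⟩ := (fderiv ℝ ψ w).toLinearMap.exists_leftInverse_of_injective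
    (LinearMap.ker_eq_bot.2 (hψ.immersion w hw))
  set g : E2 → E2 := fun b => G.toContinuousLinearMap (ψ b) with hg
  have hgc : ContDiffAt ℝ ∞ g w :=
    G.toContinuousLinearMap.contDiff.contDiffAt.comp w (hψ.contDiffAt hw)
  have hgd : HasFDerivAt g ((ContinuousLinearEquiv.refl ℝ E2 : E2 ≃L[ℝ] E2) : E2 →L[ℝ] E2) w := by
    have := G.toContinuousLinearMap.hasFDerivAt.comp w (hψ.differentiableAt hw).hasFDerivAt
    convert! this using 1
    ext1 v
    exact (LinearMap.congr_fun hG v).symm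
  have hst := hgc.hasStrictFDerivAt' hgd (by simp)
  set h : E2 → E2 := hst.localInverse with hh
  have hinv : ContDiffAt ℝ ∞ h (g w) := hgc.to_localInverse hgd (by simp)
  have hleft : ∀ᶠ b in 𝓝 w, h (g b) = b := hst.eventually_left_inverse
  have huw' : G.toContinuousLinearMap (φ u) = g w := by rw [huw]
  refine ⟨fun a => h (G.toContinuousLinearMap (φ a)), ?_, ?_, ?_⟩
  · refine ContDiffAt.comp u (by rwa [huw']) ?_
    exact G.toContinuousLinearMap.contDiff.contDiffAt.comp u (hφ.contDiffAt hu)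
  · change h (G.toContinuousLinearMap (φ u)) = w
    rw [huw']; exact hleft.self_of_nhds
  -- Relative openness of `ψ '' W` in `S` is what puts `φ a` on the sheet `ψ '' W`; without it only
  -- the `G`-projections would agree.
  · obtain ⟨W, hW, hWo, hwW⟩ := eventually_nhds_iff.1 (hleft.and (hψ.isOpen.mem_nhds hw))
    obtain ⟨O, hO, hOW⟩ := hψ.open_image W (fun b hb => (hW b hb).2) hWo
    have huO : φ u ∈ O := by
      rw [huw]; exact (hOW.subset (mem_image_of_mem ψ hwW)).2
    filter_upwards [(hφ.differentiableAt hu).continuousAt.preimage_mem_nhds (hO.mem_nhds huO),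
      hφ.isOpen.mem_nhds hu] with a haO haU
    obtain ⟨b, hb, hba⟩ := hOW.symm.subset ⟨hφ.mapsTo haU, haO⟩
    have : h (G.toContinuousLinearMap (φ a)) = b := by
      rw [← hba]; exact (hW b hb).1
    rw [this]
    exact ⟨(hW b hb).2, hba.symm⟩

/-- The Jacobian matrix of a map of the plane. -/
noncomputable def jacobianMatrix (A : E2 →L[ℝ] E2) : Matrix (Fin 2) (Fin 2) ℝ :=
  Matrix.of fun c a => A (coordVec a) c

theorem fderiv_coordVec (φ : E2 → E3) (u v : E2) :
    fderiv ℝ φ u v = v 0 • covBasis φ 0 u + v 1 • covBasis φ 1 u := by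
  conv_lhs => rw [eq_sum_coordVec v]
  simp [covBasis]

theorem isUnit_jacobianMatrix {A : E2 →L[ℝ] E2} (hA : Function.Injective A) :
    IsUnit (jacobianMatrix A) := by
  rw [← Matrix.mulVec_injective_iff_isUnit]
  intro x y hxy
  have key : ∀ z : Fin 2 → ℝ, (jacobianMatrix A).mulVec z = (A (WithLp.toLp 2 z)).ofLp := by
    intro z
    rw [eq_sum_coordVec (WithLp.toLp 2 z)]
    funext i
    simp [jacobianMatrix, Matrix.mulVec, dotProduct, mul_comm]
  rw [key, key] at hxy
  have := hA (WithLp.ofLp_injective 2 hxy)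
  exact WithLp.toLp_injective 2 this

theorem metricTensor_of_fderiv_comp {A : E2 →L[ℝ] E2}
    (h : fderiv ℝ φ u = (fderiv ℝ ψ w).comp A) :
    metricTensor φ u = (jacobianMatrix A).transpose * metricTensor ψ w * jacobianMatrix A := by
  ext a b
  simp only [metricTensor, covBasis, h, ContinuousLinearMap.comp_apply, Matrix.of_apply]
  rw [fderiv_coordVec ψ w (A (coordVec a)), fderiv_coordVec ψ w (A (coordVec b))]
  simp only [Matrix.mul_apply, Fin.sum_univ_two, inner_add_left, inner_add_right, inner_smul_left,
    inner_smul_right, jacobianMatrix, Matrix.transpose_apply, Matrix.of_apply, covBasis]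
  simp
  ring

theorem IsLocalParam.curvatureTensor_of_transition (hψ : IsLocalParam S ψ V) (hw : w ∈ V)
    {τ : E2 → E2} (hτ : ContDiffAt ℝ ∞ τ u) (hτu : τ u = w)
    (hev : ∀ᶠ a in 𝓝 u, τ a ∈ V ∧ φ a = ψ (τ a)) {N : E3}
    (hN : IsUnitNormal ψ w N) :
    curvatureTensor φ u N = (jacobianMatrix (fderiv ℝ τ u)).transpose * curvatureTensor ψ w N *
      jacobianMatrix (fderiv ℝ τ u) := by
  have hd : ∀ᶠ a in 𝓝 u, fderiv ℝ φ a = (fderiv ℝ ψ (τ a)).comp (fderiv ℝ τ a) := by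
    have h2 : ∀ᶠ a in 𝓝 u, ContDiffAt ℝ 1 τ a :=
      (hτ.of_le (by exact_mod_cast le_top)).eventually (by simp)
    filter_upwards [hev.eventually_nhds, h2] with a ha ha2
    have e : φ =ᶠ[𝓝 a] ψ ∘ τ := ha.mono fun b hb => hb.2
    rw [e.fderiv_eq]
    exact fderiv_comp a (hψ.differentiableAt ha.self_of_nhds.1)
      (ha2.differentiableAt one_ne_zero)
  have hψ1 : DifferentiableAt ℝ (fderiv ℝ ψ) w :=
    ((hψ.contDiffAt hw).fderiv_right (m := 1) one_add_one_le_infty).differentiableAt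
      one_ne_zero
  have hτ1 : DifferentiableAt ℝ (fderiv ℝ τ) u :=
    (hτ.fderiv_right (m := 1) one_add_one_le_infty).differentiableAt one_ne_zero
  have hτ0 : DifferentiableAt ℝ τ u := hτ.differentiableAt (by simp)
  have hcov : ∀ (b : Fin 2), HasFDerivAt (covBasis ψ b) (((ContinuousLinearMap.apply ℝ E3
      (coordVec b)).comp (fderiv ℝ (fderiv ℝ ψ) w))) w := fun b =>
    (ContinuousLinearMap.apply ℝ E3 (coordVec b)).hasFDerivAt.comp w hψ1.hasFDerivAt
  -- The second derivative of `ψ ∘ τ` contains the term `dψ(D²τ)`, which is tangential. Pairing with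
  -- `N` kills it, so the curvature tensor transforms as a bilinear form.
  have hN' : ∀ v, inner ℝ N (fderiv ℝ ψ w v) = 0 := fun v => by
    rw [fderiv_coordVec, inner_add_right, inner_smul_right, inner_smul_right, hN.2, hN.2]
    simp
  set B := fderiv ℝ (fderiv ℝ ψ) w with hB
  set A := fderiv ℝ τ u with hA
  have key : ∀ a b, curvatureTensor φ u N a b =
      inner ℝ N (B (A (coordVec a)) (A (coordVec b))) := by
    intro a b
    have e : covBasis φ b =ᶠ[𝓝 u] fun x => fderiv ℝ ψ (τ x) (fderiv ℝ τ x (coordVec b)) :=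
      hd.mono fun x hx => by simp [covBasis, hx]
    have h1 : HasFDerivAt (fun x => fderiv ℝ ψ (τ x)) (B.comp A) u := by
      refine HasFDerivAt.comp u ?_ hτ0.hasFDerivAt
      rw [hτu]; exact hψ1.hasFDerivAt
    have h2 : HasFDerivAt (fun x => fderiv ℝ τ x (coordVec b))
        ((ContinuousLinearMap.apply ℝ E2 (coordVec b)).comp (fderiv ℝ (fderiv ℝ τ) u)) u :=
      (ContinuousLinearMap.apply ℝ E2 (coordVec b)).hasFDerivAt.comp u hτ1.hasFDerivAt
    have h3 := h1.clm_apply h2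
    rw [curvatureTensor, Matrix.of_apply, e.fderiv_eq, h3.fderiv]
    simp only [add_apply, ContinuousLinearMap.comp_apply,
      ContinuousLinearMap.flip_apply, inner_add_right, hτu, hN', zero_add]
    rfl
  have key2 : ∀ a b, curvatureTensor ψ w N a b = inner ℝ N (B (coordVec a) (coordVec b)) := by
    intro a b
    rw [curvatureTensor, Matrix.of_apply, (hcov b).fderiv]
    rfl
  ext a b
  rw [key, eq_sum_coordVec (A (coordVec a)), eq_sum_coordVec (A (coordVec b))]
  simp only [map_add, map_smul, add_apply, smul_apply,
    Matrix.mul_apply, Fin.sum_univ_two, inner_add_right, inner_smul_right, jacobianMatrix,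
    Matrix.transpose_apply, Matrix.of_apply, key2]
  ring

theorem meanCurvature_eq_trace (φ : E2 → E3) (u : E2) (N : E3) :
    meanCurvature φ u N = ((metricTensor φ u)⁻¹ * (curvatureTensor φ u N).transpose).trace := by
  simp [meanCurvature, Matrix.trace, Matrix.mul_apply]

theorem IsLocalParam.fderiv_of_transition (hψ : IsLocalParam S ψ V) (hw : w ∈ V) {τ : E2 → E2}
    (hτ : ContDiffAt ℝ ∞ τ u) (hτu : τ u = w) (hev : ∀ᶠ a in 𝓝 u, τ a ∈ V ∧ φ a = ψ (τ a)) :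
    fderiv ℝ φ u = (fderiv ℝ ψ w).comp (fderiv ℝ τ u) := by
  have e : φ =ᶠ[𝓝 u] ψ ∘ τ := hev.mono fun b hb => hb.2
  rw [e.fderiv_eq, ← hτu]
  exact fderiv_comp u (by rw [hτu]; exact hψ.differentiableAt hw) (hτ.differentiableAt (by simp))

theorem injective_fderiv_transition {A : E2 →L[ℝ] E2} (hφ : Function.Injective (fderiv ℝ φ u))
    (h : fderiv ℝ φ u = (fderiv ℝ ψ w).comp A) : Function.Injective A := by
  rw [h] at hφ
  exact Function.Injective.of_comp (f := fderiv ℝ ψ w) hφ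

theorem range_fderiv_of_transition {A : E2 →L[ℝ] E2} (hφ : Function.Injective (fderiv ℝ φ u))
    (h : fderiv ℝ φ u = (fderiv ℝ ψ w).comp A) :
    LinearMap.range (fderiv ℝ φ u).toLinearMap = LinearMap.range (fderiv ℝ ψ w).toLinearMap := by
  have hA := injective_fderiv_transition hφ h
  have hs : LinearMap.range A.toLinearMap = ⊤ :=
    LinearMap.range_eq_top.2 (LinearMap.injective_iff_surjective.1 hA)
  have : (fderiv ℝ φ u).toLinearMap = (fderiv ℝ ψ w).toLinearMap ∘ₗ A.toLinearMap := by
    rw [h]; rfl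
  rw [this, LinearMap.range_comp, hs, Submodule.map_top]

/-- The mean curvature consistent with a given unit normal does not depend on the chart. -/
theorem IsLocalParam.meanCurvature_eq (hφ : IsLocalParam S φ U) (hψ : IsLocalParam S ψ V)
    (hu : u ∈ U) (hw : w ∈ V) (huw : φ u = ψ w) {N : E3} (hN : IsUnitNormal ψ w N) :
    meanCurvature φ u N = meanCurvature ψ w N := by
  obtain ⟨τ, hτ, hτu, hev⟩ := hφ.exists_transition hψ hu hw huw
  have hd := hψ.fderiv_of_transition hw hτ hτu hev
  have hA := isUnit_jacobianMatrix (injective_fderiv_transition (hφ.immersion u hu) hd)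
  rw [meanCurvature_eq_trace, meanCurvature_eq_trace, metricTensor_of_fderiv_comp hd,
    hψ.curvatureTensor_of_transition hw hτ hτu hev hN]
  set M := jacobianMatrix (fderiv ℝ τ u)
  have hdet : IsUnit M.det := (Matrix.isUnit_iff_isUnit_det M).1 hA
  have hMT : IsUnit M.transpose.det := by rwa [Matrix.det_transpose]
  rw [Matrix.mul_inv_rev, Matrix.mul_inv_rev, Matrix.transpose_mul, Matrix.transpose_mul,
    Matrix.transpose_transpose, Matrix.trace_mul_comm]
  have e : M.transpose * ((curvatureTensor ψ w N).transpose * M) *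
      (M⁻¹ * ((metricTensor ψ w)⁻¹ * M.transpose⁻¹)) =
      M.transpose * ((curvatureTensor ψ w N).transpose * (M * M⁻¹) *
        (metricTensor ψ w)⁻¹) * M.transpose⁻¹ := by
    simp only [Matrix.mul_assoc]
  rw [e, Matrix.mul_nonsing_inv _ hdet, Matrix.mul_one, Matrix.trace_mul_comm, ← Matrix.mul_assoc,
    Matrix.nonsing_inv_mul _ hMT, Matrix.one_mul, Matrix.trace_mul_comm]

theorem IsUnitNormal.mem_orthogonal {N : E3} (hN : IsUnitNormal φ u N) :
    N ∈ (LinearMap.range (fderiv ℝ φ u).toLinearMap)ᗮ := by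
  rw [Submodule.mem_orthogonal']
  rintro _ ⟨v, rfl⟩
  rw [ContinuousLinearMap.coe_coe, fderiv_coordVec, inner_add_right, inner_smul_right,
    inner_smul_right, hN.2, hN.2]
  simp

theorem isUnitNormal_iff {N : E3} :
    IsUnitNormal φ u N ↔ ‖N‖ = 1 ∧ N ∈ (LinearMap.range (fderiv ℝ φ u).toLinearMap)ᗮ :=
  ⟨fun h => ⟨h.1, h.mem_orthogonal⟩, fun h => ⟨h.1, fun a =>
    (Submodule.mem_orthogonal' _ _).1 h.2 _ ⟨coordVec a, rfl⟩⟩⟩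

theorem finrank_orthogonal_range (h : Function.Injective (fderiv ℝ φ u)) :
    Module.finrank ℝ ↥(LinearMap.range (fderiv ℝ φ u).toLinearMap)ᗮ = 1 := by
  have h1 := Submodule.finrank_add_finrank_orthogonal (LinearMap.range (fderiv ℝ φ u).toLinearMap)
  rw [LinearMap.finrank_range_of_inj h] at h1
  simp at h1
  omega

theorem exists_isUnitNormal (h : Function.Injective (fderiv ℝ φ u)) :
    ∃ N, IsUnitNormal φ u N := by
  have := finrank_orthogonal_range h
  have hnt : Nontrivial ↥(LinearMap.range (fderiv ℝ φ u).toLinearMap)ᗮ :=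
    Module.nontrivial_of_finrank_pos (R := ℝ) (by omega)
  obtain ⟨⟨N, hN⟩, hN0⟩ := exists_ne (0 : ↥(LinearMap.range (fderiv ℝ φ u).toLinearMap)ᗮ)
  have hN0' : N ≠ 0 := fun h => hN0 (by simpa using h)
  refine ⟨‖N‖⁻¹ • N, isUnitNormal_iff.2 ⟨?_, Submodule.smul_mem _ _ hN⟩⟩
  rw [norm_smul, norm_inv, norm_norm, inv_mul_cancel₀ (norm_ne_zero_iff.2 hN0')]

theorem IsUnitNormal.eq_inner_smul {N v : E3} (h : Function.Injective (fderiv ℝ φ u))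
    (hN : IsUnitNormal φ u N) (hv : v ∈ (LinearMap.range (fderiv ℝ φ u).toLinearMap)ᗮ) :
    v = inner ℝ N v • N := by
  have hN0 : (⟨N, hN.mem_orthogonal⟩ : ↥(LinearMap.range (fderiv ℝ φ u).toLinearMap)ᗮ) ≠ 0 := by
    intro h0
    have : N = 0 := congrArg Subtype.val h0
    simpa [this] using hN.1
  obtain ⟨c, hc⟩ := exists_smul_eq_of_finrank_eq_one (finrank_orthogonal_range h) hN0 ⟨v, hv⟩
  have hc' : c • N = v := congrArg Subtype.val hc
  rw [← hc', inner_smul_right, real_inner_self_eq_norm_sq, hN.1]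
  simp

theorem meanCurvature_smul (φ : E2 → E3) (u : E2) (c : ℝ) (N : E3) :
    meanCurvature φ u (c • N) = c * meanCurvature φ u N := by
  simp only [meanCurvature, curvatureTensor, Matrix.of_apply, inner_smul_left, Fin.sum_univ_two]
  simp
  ring

/-- Two unit normals at a point differ by a sign, which enters twice. -/
theorem meanCurvature_smul_eq {N N' : E3} (h : Function.Injective (fderiv ℝ φ u))
    (hN : IsUnitNormal φ u N) (hN' : IsUnitNormal φ u N') :
    meanCurvature φ u N • N = meanCurvature φ u N' • N' := by
  have h1 := hN.eq_inner_smul h hN'.mem_orthogonal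
  set c := inner ℝ N N'
  have hc : c * c = 1 := by
    have h2 := hN'.1
    rw [h1, norm_smul, hN.1, mul_one, Real.norm_eq_abs] at h2
    rw [← abs_mul_abs_self, h2, one_mul]
  rw [h1, meanCurvature_smul, smul_smul, mul_right_comm, hc, one_mul]

/-- The mean curvature vector `N B^a_a` of a surface at the point `x`. -/
noncomputable def meanCurvatureVector (S : Set E3) (x : E3) : E3 :=
  Classical.epsilon fun v => ∃ (φ : E2 → E3) (U : Set E2) (u : E2) (N : E3),
    IsLocalParam S φ U ∧ u ∈ U ∧ φ u = x ∧ IsUnitNormal φ u N ∧ v = meanCurvature φ u N • N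

theorem IsLocalParam.meanCurvatureVector_eq (hφ : IsLocalParam S φ U) (hu : u ∈ U) {N : E3}
    (hN : IsUnitNormal φ u N) : meanCurvatureVector S (φ u) = meanCurvature φ u N • N := by
  obtain ⟨ψ, V, w, N', hψ, hw, hwu, hN', h⟩ := Classical.epsilon_spec
    (p := fun v => ∃ (ψ : E2 → E3) (V : Set E2) (w : E2) (N : E3),
      IsLocalParam S ψ V ∧ w ∈ V ∧ ψ w = φ u ∧ IsUnitNormal ψ w N ∧ v = meanCurvature ψ w N • N)
    ⟨_, φ, U, u, N, hφ, hu, rfl, hN, rfl⟩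
  obtain ⟨τ, hτ, hτu, hev⟩ := hψ.exists_transition hφ hw hu hwu
  have hr := range_fderiv_of_transition (hψ.immersion w hw)
    (hφ.fderiv_of_transition hu hτ hτu hev)
  have hN'' : IsUnitNormal φ u N' := by
    rw [isUnitNormal_iff, ← hr]; exact isUnitNormal_iff.1 hN'
  rw [meanCurvatureVector, h, hψ.meanCurvature_eq hφ hw hu hwu hN'',
    meanCurvature_smul_eq (hφ.immersion u hu) hN'' hN]

/-- The tangent plane of a surface at the point `x`. -/
noncomputable def tangentPlane (S : Set E3) (x : E3) : Submodule ℝ E3 :=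
  Classical.epsilon fun K => ∃ (φ : E2 → E3) (U : Set E2) (u : E2),
    IsLocalParam S φ U ∧ u ∈ U ∧ φ u = x ∧ K = LinearMap.range (fderiv ℝ φ u).toLinearMap

theorem IsLocalParam.tangentPlane_eq (hφ : IsLocalParam S φ U) (hu : u ∈ U) :
    tangentPlane S (φ u) = LinearMap.range (fderiv ℝ φ u).toLinearMap := by
  obtain ⟨ψ, V, w, hψ, hw, hwu, h⟩ := Classical.epsilon_spec
    (p := fun K => ∃ (ψ : E2 → E3) (V : Set E2) (w : E2),
      IsLocalParam S ψ V ∧ w ∈ V ∧ ψ w = φ u ∧ K = LinearMap.range (fderiv ℝ ψ w).toLinearMap)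
    ⟨_, φ, U, u, hφ, hu, rfl, rfl⟩
  obtain ⟨τ, hτ, hτu, hev⟩ := hψ.exists_transition hφ hw hu hwu
  rw [tangentPlane, h]
  exact range_fderiv_of_transition (hψ.immersion w hw) (hφ.fderiv_of_transition hu hτ hτu hev)

end Charts

/-! ### The conormal densities and their divergence. -/

section Conormal

variable {S : Set E3} {φ : E2 → E3} {U : Set E2} {u : E2}

/-- The area density `√(det S_ab)` of a parametrization. -/
noncomputable def areaDensity (φ : E2 → E3) (u : E2) : ℝ := (fderiv ℝ φ u).toLinearMap.normDet

theorem areaDensity_sq (φ : E2 → E3) (u : E2) :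
    areaDensity φ u ^ 2 = inner ℝ (covBasis φ 0 u) (covBasis φ 0 u) *
      inner ℝ (covBasis φ 1 u) (covBasis φ 1 u) -
      inner ℝ (covBasis φ 0 u) (covBasis φ 1 u) ^ 2 := by
  have := (fderiv ℝ φ u).toLinearMap.normDet_sq_eq_det_gram (EuclideanSpace.basisFun (Fin 2) ℝ)
  rw [Matrix.det_fin_two] at this
  simp only [Matrix.gram_apply, EuclideanSpace.basisFun_apply, ContinuousLinearMap.coe_coe] at this
  change areaDensity φ u ^ 2 = _ at this
  rw [this, sq]
  congr 2
  exact real_inner_comm _ _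

/-- The contravariant vector densities `√(det S_ab) S^{ab} S_b`. -/
noncomputable def conormal (φ : E2 → E3) (a : Fin 2) (u : E2) : E3 :=
  ((areaDensity φ u)⁻¹ * (metricTensor φ u).adjugate a 0) • covBasis φ 0 u +
    ((areaDensity φ u)⁻¹ * (metricTensor φ u).adjugate a 1) • covBasis φ 1 u

theorem conormal_zero (φ : E2 → E3) (u : E2) : conormal φ 0 u =
    ((areaDensity φ u)⁻¹ * inner ℝ (covBasis φ 1 u) (covBasis φ 1 u)) • covBasis φ 0 u +
    ((areaDensity φ u)⁻¹ * -inner ℝ (covBasis φ 0 u) (covBasis φ 1 u)) • covBasis φ 1 u := by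
  simp [conormal, Matrix.adjugate_fin_two, metricTensor]

theorem conormal_one (φ : E2 → E3) (u : E2) : conormal φ 1 u =
    ((areaDensity φ u)⁻¹ * -inner ℝ (covBasis φ 0 u) (covBasis φ 1 u)) • covBasis φ 0 u +
    ((areaDensity φ u)⁻¹ * inner ℝ (covBasis φ 0 u) (covBasis φ 0 u)) • covBasis φ 1 u := by
  simp [conormal, Matrix.adjugate_fin_two, metricTensor, real_inner_comm]

theorem IsLocalParam.areaDensity_pos (h : IsLocalParam S φ U) (hu : u ∈ U) :
    0 < areaDensity φ u := normDet_pos (h.immersion u hu)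

/-- The conormals are `J` times the basis dual to `S_b`, because the adjugate of the metric is `J²`
times its inverse. -/
theorem IsLocalParam.inner_conormal (h : IsLocalParam S φ U) (hu : u ∈ U) (a b : Fin 2) :
    inner ℝ (conormal φ a u) (covBasis φ b u) = if a = b then areaDensity φ u else 0 := by
  have h0 := h.areaDensity_pos hu
  have h2 := areaDensity_sq φ u
  have hc := real_inner_comm (covBasis φ 0 u) (covBasis φ 1 u)
  fin_cases a <;> fin_cases b <;>
  simp [conormal_zero, conormal_one, inner_add_left, inner_smul_left] <;>
  field_simp <;> (try rw [hc]) <;> simp only [← real_inner_self_eq_norm_sq] <;> nlinarith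

theorem conormal_mem_range (φ : E2 → E3) (a : Fin 2) (u : E2) :
    conormal φ a u ∈ LinearMap.range (fderiv ℝ φ u).toLinearMap :=
  Submodule.add_mem _ (Submodule.smul_mem _ _ ⟨_, rfl⟩) (Submodule.smul_mem _ _ ⟨_, rfl⟩)

/-- This makes the flux density of `F⁰` across a line `u⁰ = const` match the arc length density
`|S_1|`. -/
theorem IsLocalParam.norm_conormal_zero (h : IsLocalParam S φ U) (hu : u ∈ U) :
    ‖conormal φ 0 u‖ = ‖covBasis φ 1 u‖ := by
  have h0 := h.areaDensity_pos hu
  rw [← sq_eq_sq₀ (norm_nonneg _) (norm_nonneg _), ← real_inner_self_eq_norm_sq,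
    ← real_inner_self_eq_norm_sq]
  conv_lhs => rw [conormal_zero, inner_add_left, inner_smul_left, inner_smul_left,
    ← conormal_zero, real_inner_comm (conormal φ 0 u), h.inner_conormal hu,
    real_inner_comm (conormal φ 0 u), h.inner_conormal hu]
  simp
  field_simp

theorem IsLocalParam.covBasis_ne_zero (h : IsLocalParam S φ U) (hu : u ∈ U) (a : Fin 2) :
    covBasis φ a u ≠ 0 := by
  intro h0
  have := h.immersion u hu (h0.trans (map_zero _).symm)
  simpa [coordVec] using congrArg (fun v : E2 => v a) this

theorem IsLocalParam.contDiffAt_covBasis (h : IsLocalParam S φ U) (hu : u ∈ U) (a : Fin 2) :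
    ContDiffAt ℝ 1 (covBasis φ a) u :=
  (ContinuousLinearMap.apply ℝ E3 (coordVec a)).contDiff.contDiffAt.comp u
    ((h.contDiffAt hu).fderiv_right one_add_one_le_infty)

theorem IsLocalParam.contDiffAt_areaDensity (h : IsLocalParam S φ U) (hu : u ∈ U) :
    ContDiffAt ℝ 1 (areaDensity φ) u := by
  have e : areaDensity φ = fun u => √(inner ℝ (covBasis φ 0 u) (covBasis φ 0 u) *
      inner ℝ (covBasis φ 1 u) (covBasis φ 1 u) -
      inner ℝ (covBasis φ 0 u) (covBasis φ 1 u) ^ 2) := by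
    funext u
    rw [← areaDensity_sq]
    exact (Real.sqrt_sq (LinearMap.normDet_nonneg _)).symm
  rw [e]
  have h0 := h.contDiffAt_covBasis hu 0
  have h1 := h.contDiffAt_covBasis hu 1
  refine ContDiffAt.sqrt ?_ ?_
  · exact ((h0.inner ℝ h0).mul (h1.inner ℝ h1)).sub ((h0.inner ℝ h1).pow 2)
  · rw [← areaDensity_sq]
    exact pow_ne_zero _ (h.areaDensity_pos hu).ne'

theorem IsLocalParam.contDiffAt_conormal (h : IsLocalParam S φ U) (hu : u ∈ U) (a : Fin 2) :
    ContDiffAt ℝ 1 (conormal φ a) u := by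
  have hJ := (h.contDiffAt_areaDensity hu).inv (h.areaDensity_pos hu).ne'
  have h0 := h.contDiffAt_covBasis hu 0
  have h1 := h.contDiffAt_covBasis hu 1
  fin_cases a
  · refine ContDiffAt.congr_of_eventuallyEq ?_ (Eventually.of_forall fun u => conormal_zero φ u)
    exact ((hJ.mul (h1.inner ℝ h1)).smul h0).add ((hJ.mul (h0.inner ℝ h1).neg).smul h1)
  · refine ContDiffAt.congr_of_eventuallyEq ?_ (Eventually.of_forall fun u => conormal_one φ u)
    exact ((hJ.mul (h0.inner ℝ h1).neg).smul h0).add ((hJ.mul (h0.inner ℝ h0)).smul h1)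

theorem IsLocalParam.fderiv_covBasis_comm (h : IsLocalParam S φ U) (hu : u ∈ U) (a b : Fin 2) :
    fderiv ℝ (covBasis φ a) u (coordVec b) = fderiv ℝ (covBasis φ b) u (coordVec a) := by
  have hd : DifferentiableAt ℝ (fderiv ℝ φ) u :=
    ((h.contDiffAt hu).fderiv_right (m := 1) one_add_one_le_infty).differentiableAt one_ne_zero
  have hs : IsSymmSndFDerivAt ℝ φ u := (h.contDiffAt hu).isSymmSndFDerivAt (by
    simp only [minSmoothness_of_isRCLikeNormedField]
    rw [← one_add_one_eq_two]; exact one_add_one_le_infty)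
  have hc : ∀ b : Fin 2, fderiv ℝ (covBasis φ b) u = (ContinuousLinearMap.apply ℝ E3
      (coordVec b)).comp (fderiv ℝ (fderiv ℝ φ) u) := fun b =>
    ((ContinuousLinearMap.apply ℝ E3 (coordVec b)).hasFDerivAt.comp u hd.hasFDerivAt).fderiv
  rw [hc, hc]
  exact hs.eq _ _

/-- The conormal densities have divergence `√(det S_ab) N B^a_a`. -/
theorem IsLocalParam.div_conormal (h : IsLocalParam S φ U) (hu : u ∈ U) :
    fderiv ℝ (conormal φ 0) u (coordVec 0) + fderiv ℝ (conormal φ 1) u (coordVec 1) =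
      areaDensity φ u • meanCurvatureVector S (φ u) := by
  obtain ⟨N, hN⟩ := exists_isUnitNormal (h.immersion u hu)
  rw [h.meanCurvatureVector_eq hu hN]
  have hJ0 := h.areaDensity_pos hu
  have hJ := ((h.contDiffAt_areaDensity hu).differentiableAt one_ne_zero)
  have hS := fun a => ((h.contDiffAt_covBasis hu a).differentiableAt one_ne_zero)
  have hF := fun a => ((h.contDiffAt_conormal hu a).differentiableAt one_ne_zero)
  set v := fderiv ℝ (conormal φ 0) u (coordVec 0) + fderiv ℝ (conormal φ 1) u (coordVec 1) with hv
  -- The tangential part vanishes: differentiating `F^a · S_c = J δ^a_c` leaves `∂_c J - F^a · ∂_a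
  -- S_c`. This is zero by `∂_a S_c = ∂_c S_a` and the formula `∂_c J = F^a · ∂_c S_a`.
  have hperp : ∀ c, inner ℝ v (covBasis φ c u) = 0 := by
    intro c
    have e1 : ∀ a, inner ℝ (conormal φ a u) (fderiv ℝ (covBasis φ c) u (coordVec a)) +
        inner ℝ (fderiv ℝ (conormal φ a) u (coordVec a)) (covBasis φ c u) =
        if a = c then fderiv ℝ (areaDensity φ) u (coordVec a) else 0 := by
      intro a
      rw [← fderiv_inner_apply ℝ (hF a) (hS c)]
      have : (fun t => inner ℝ (conormal φ a t) (covBasis φ c t)) =ᶠ[𝓝 u]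
          fun t => if a = c then areaDensity φ t else 0 := by
        filter_upwards [h.isOpen.mem_nhds hu] with t ht using h.inner_conormal ht a c
      rw [this.fderiv_eq]
      split_ifs <;> simp
    have e2 := e1 0
    have e3 := e1 1
    -- Jacobi's formula for `∂_c J`, obtained by differentiating the polynomial expression for `J²`.
    have e4 : 2 * areaDensity φ u * fderiv ℝ (areaDensity φ) u (coordVec c) =
        2 * areaDensity φ u *
        (inner ℝ (conormal φ 0 u) (fderiv ℝ (covBasis φ 0) u (coordVec c)) +
        inner ℝ (conormal φ 1 u) (fderiv ℝ (covBasis φ 1) u (coordVec c))) := by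
      have e5 : fderiv ℝ (fun t => areaDensity φ t ^ 2) u (coordVec c) =
          2 * areaDensity φ u * fderiv ℝ (areaDensity φ) u (coordVec c) := by
        rw [(hJ.hasFDerivAt.pow 2).fderiv]
        simp
      rw [← e5, show (fun t => areaDensity φ t ^ 2) = _ from funext (areaDensity_sq φ)]
      have d00 := ((hS 0).hasFDerivAt.inner ℝ (hS 0).hasFDerivAt)
      have d01 := ((hS 0).hasFDerivAt.inner ℝ (hS 1).hasFDerivAt)
      have d11 := ((hS 1).hasFDerivAt.inner ℝ (hS 1).hasFDerivAt)
      rw [((d00.fun_mul d11).fun_sub (d01.pow 2)).fderiv, conormal_zero, conormal_one]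
      simp only [inner_add_left, inner_smul_left, fderivInnerCLM_apply, sub_apply, add_apply,
        smul_apply, ContinuousLinearMap.comp_apply, ContinuousLinearMap.prod_apply]
      simp [real_inner_comm]
      field_simp
      ring
    have e6 := mul_left_cancel₀ (by positivity) e4
    rw [hv, inner_add_left]
    rw [h.fderiv_covBasis_comm hu 0 c, h.fderiv_covBasis_comm hu 1 c] at e6
    fin_cases c <;> simp at e2 e3 e6 ⊢ <;> linarith
  have hvo : v ∈ (LinearMap.range (fderiv ℝ φ u).toLinearMap)ᗮ := by
    rw [Submodule.mem_orthogonal']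
    rintro _ ⟨t, rfl⟩
    rw [ContinuousLinearMap.coe_coe, fderiv_coordVec, inner_add_right, inner_smul_right,
      inner_smul_right, hperp, hperp]
    simp
  rw [hN.eq_inner_smul (h.immersion u hu) hvo, smul_smul]
  congr 1
  -- In the normal component the derivatives of the coefficients drop out, since they multiply
  -- tangent vectors.
  have hNF : ∀ (a : Fin 2) (p q : E2 → ℝ), DifferentiableAt ℝ p u → DifferentiableAt ℝ q u →
      inner ℝ N (fderiv ℝ (fun t => p t • covBasis φ 0 t + q t • covBasis φ 1 t) u (coordVec a)) =
      p u * curvatureTensor φ u N a 0 + q u * curvatureTensor φ u N a 1 := by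
    intro a p q hp hq
    rw [((hp.hasFDerivAt.fun_smul (hS 0).hasFDerivAt).fun_add
      (hq.hasFDerivAt.fun_smul (hS 1).hasFDerivAt)).fderiv]
    simp [inner_add_right, inner_smul_right, hN.2, curvatureTensor]
  have g := fun a b => (hS a).inner ℝ (hS b)
  have hJi := hJ.fun_inv hJ0.ne'
  rw [hv, inner_add_right, show conormal φ 0 = _ from funext (conormal_zero φ),
    show conormal φ 1 = _ from funext (conormal_one φ),
    hNF 0 _ _ (hJi.fun_mul (g 1 1)) (hJi.fun_mul (g 0 1).fun_neg),
    hNF 1 _ _ (hJi.fun_mul (g 0 1).fun_neg) (hJi.fun_mul (g 0 0)), meanCurvature, Matrix.inv_def,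
    Matrix.det_fin_two, Matrix.adjugate_fin_two]
  have h2 := areaDensity_sq φ u
  have hd : metricTensor φ u 0 0 * metricTensor φ u 1 1 - metricTensor φ u 0 1 * metricTensor φ u 1 0
      = areaDensity φ u ^ 2 := by
    rw [h2]; simp [metricTensor, real_inner_comm, sq]
  rw [hd, Ring.inverse_eq_inv']
  simp [Fin.sum_univ_two, metricTensor, real_inner_comm]
  field_simp

/-- Both sides are tangent and have the same inner products with `S_0` and `S_1`. With `e` the
gradient of `χ`, this identifies the term that a cutoff adds to the divergence. -/
theorem IsLocalParam.sum_inner_smul_conormal (h : IsLocalParam S φ U) (hu : u ∈ U) (e : E3) :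
    (inner ℝ e (covBasis φ 0 u) : ℝ) • conormal φ 0 u +
      (inner ℝ e (covBasis φ 1 u) : ℝ) • conormal φ 1 u =
      areaDensity φ u • (tangentPlane S (φ u)).starProjection e := by
  have hJ0 := h.areaDensity_pos hu
  rw [h.tangentPlane_eq hu, ← map_smul]
  symm
  refine Submodule.eq_starProjection_of_mem_orthogonal
    (Submodule.add_mem _ (Submodule.smul_mem _ _ (conormal_mem_range _ _ _))
      (Submodule.smul_mem _ _ (conormal_mem_range _ _ _))) ?_
  rw [Submodule.mem_orthogonal']
  have hp : ∀ c, inner ℝ (areaDensity φ u • e - ((inner ℝ e (covBasis φ 0 u) : ℝ) • conormal φ 0 u +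
      (inner ℝ e (covBasis φ 1 u) : ℝ) • conormal φ 1 u)) (covBasis φ c u) = 0 := by
    intro c
    simp only [inner_sub_left, inner_add_left, inner_smul_left, h.inner_conormal hu]
    fin_cases c <;> simp [mul_comm]
  rintro _ ⟨t, rfl⟩
  rw [ContinuousLinearMap.coe_coe, fderiv_coordVec, inner_add_right, inner_smul_right,
    inner_smul_right, hp, hp]
  simp

/-- The surface density `χ N B^a_a + ∇χ`, with the tangential gradient of `χ`, whose integral over
a patch is the contour integral of `χ n`. -/
noncomputable def stokesDensity (S : Set E3) (χ : E3 → ℝ) (x : E3) : E3 :=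
  χ x • meanCurvatureVector S x + (tangentPlane S x).starProjection (gradient χ x)

theorem IsLocalParam.div_smul_conormal (h : IsLocalParam S φ U) (hu : u ∈ U) {χ : E3 → ℝ}
    (hχ : DifferentiableAt ℝ χ (φ u)) :
    fderiv ℝ (fun t => χ (φ t) • conormal φ 0 t) u (coordVec 0) +
      fderiv ℝ (fun t => χ (φ t) • conormal φ 1 t) u (coordVec 1) =
      areaDensity φ u • stokesDensity S χ (φ u) := by
  have hF := fun a => ((h.contDiffAt_conormal hu a).differentiableAt one_ne_zero)
  have hc : HasFDerivAt (fun t => χ (φ t)) ((fderiv ℝ χ (φ u)).comp (fderiv ℝ φ u)) u :=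
    hχ.hasFDerivAt.comp u (h.differentiableAt hu).hasFDerivAt
  have hg : ∀ v, fderiv ℝ χ (φ u) v = inner ℝ (gradient χ (φ u)) v := fun v => by
    rw [gradient, InnerProductSpace.toDual_symm_apply]
  have key : ∀ a, fderiv ℝ (fun t => χ (φ t) • conormal φ a t) u (coordVec a) =
      χ (φ u) • fderiv ℝ (conormal φ a) u (coordVec a) +
      (inner ℝ (gradient χ (φ u)) (covBasis φ a u) : ℝ) • conormal φ a u := by
    intro a
    rw [(hc.fun_smul (hF a).hasFDerivAt).fderiv]
    rw [← hg]
    simp [covBasis]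
  rw [key, key, stokesDensity, smul_add, ← h.sum_inner_smul_conormal hu, smul_comm,
    ← h.div_conormal hu, smul_add]
  abel

end Conormal

/-! ### The divergence theorem in the half plane. -/

section HalfPlane

/-- The identification of `ℝ × ℝ` with the coordinate plane. -/
noncomputable def planeEquiv : ℝ × ℝ ≃ᵐ E2 :=
  (MeasurableEquiv.finTwoArrow (α := ℝ)).symm.trans (MeasurableEquiv.toLp 2 (Fin 2 → ℝ))

theorem planeEquiv_apply (p : ℝ × ℝ) : planeEquiv p = p.1 • coordVec 0 + p.2 • coordVec 1 := by
  ext i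
  fin_cases i <;> simp [planeEquiv, coordVec, MeasurableEquiv.finTwoArrow, MeasurableEquiv.piFinTwo]

theorem measurePreserving_planeEquiv : MeasurePreserving planeEquiv :=
  (volume_preserving_finTwoArrow ℝ).symm.trans (PiLp.volume_preserving_toLp (Fin 2))

theorem hasCompactSupport_comp_add_smul {G : Type*} [NormedAddCommGroup G] {g : E2 → G}
    (hg : HasCompactSupport g) (v w : E2)
    (hw : w ≠ 0) : HasCompactSupport fun t : ℝ => g (v + t • w) :=
  hg.comp_isClosedEmbedding ((Homeomorph.addLeft v).isClosedEmbedding.comp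
    (isClosedEmbedding_smul_left hw))

variable {G : Type*} [NormedAddCommGroup G] [NormedSpace ℝ G] [CompleteSpace G]

theorem integral_deriv_eq_zero_of_hasCompactSupport {f : ℝ → G} (hf : ContDiff ℝ 1 f)
    (h2f : HasCompactSupport f) : ∫ t, deriv f t = 0 := by
  have hi : Integrable (deriv f) :=
    (hf.continuous_deriv le_rfl).integrable_of_hasCompactSupport h2f.deriv
  rw [← setIntegral_univ, ← Iic_union_Ioi (a := (0 : ℝ)),
    setIntegral_union (Iic_disjoint_Ioi le_rfl) measurableSet_Ioi hi.integrableOn hi.integrableOn,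
    h2f.integral_Iic_deriv_eq hf, h2f.integral_Ioi_deriv_eq hf, add_neg_cancel]

theorem coordVec_ne_zero (a : Fin 2) : coordVec a ≠ 0 := by
  intro h
  simpa [coordVec] using congrArg (fun v : E2 => v a) h

/-- The divergence theorem in the half plane `u⁰ ≤ 0`. -/
theorem integral_halfPlane_div {g₀ g₁ : E2 → G} (h₀ : ContDiff ℝ 1 g₀) (h₁ : ContDiff ℝ 1 g₁)
    (hc₀ : HasCompactSupport g₀) (hc₁ : HasCompactSupport g₁) :
    ∫ w in {w : E2 | w 0 ≤ 0}, (fderiv ℝ g₀ w (coordVec 0) + fderiv ℝ g₁ w (coordVec 1)) =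
      ∫ t : ℝ, g₀ (t • coordVec 1) := by
  have hpre : planeEquiv ⁻¹' {w : E2 | w 0 ≤ 0} = Iic 0 ×ˢ univ := by
    ext p; simp [planeEquiv_apply]
  have cont : ∀ {g : E2 → G} (a : Fin 2), ContDiff ℝ 1 g →
      Continuous fun w => fderiv ℝ g w (coordVec a) := fun a hg =>
    (hg.continuous_fderiv one_ne_zero).clm_apply continuous_const
  have int : ∀ {g : E2 → G} (a : Fin 2), ContDiff ℝ 1 g → HasCompactSupport g →
      Integrable fun w => fderiv ℝ g w (coordVec a) := fun a hg hcg =>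
    (cont a hg).integrable_of_hasCompactSupport (hcg.fderiv_apply ℝ (coordVec a))
  have slice : ∀ {g : E2 → G} (v w : E2) (t : ℝ), ContDiff ℝ 1 g →
      deriv (fun t : ℝ => g (v + t • w)) t = fderiv ℝ g (v + t • w) w := by
    intro g v w t hg
    have h1 : HasDerivAt (fun t : ℝ => v + t • w) w t := by
      simpa using ((hasDerivAt_id t).smul_const w).const_add v
    exact ((hg.differentiable one_ne_zero _).hasFDerivAt.comp_hasDerivAt t h1).deriv
  have e : ∀ {g : E2 → G} (a : Fin 2), ContDiff ℝ 1 g → HasCompactSupport g →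
      (∫ w in {w : E2 | w 0 ≤ 0}, fderiv ℝ g w (coordVec a) =
        ∫ p in (Iic 0 ×ˢ univ : Set (ℝ × ℝ)), fderiv ℝ g (planeEquiv p) (coordVec a)) ∧
      IntegrableOn (fun p => fderiv ℝ g (planeEquiv p) (coordVec a)) (Iic 0 ×ˢ univ) := by
    intro g a hg hcg
    refine ⟨?_, ?_⟩
    · rw [← hpre]
      exact (measurePreserving_planeEquiv.setIntegral_preimage_emb
        planeEquiv.measurableEmbedding (fun w => fderiv ℝ g w (coordVec a)) _).symm
    · exact ((measurePreserving_planeEquiv.integrable_comp_emb planeEquiv.measurableEmbedding).2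
        (int a hg hcg)).integrableOn
  rw [integral_add (int 0 h₀ hc₀).integrableOn (int 1 h₁ hc₁).integrableOn]
  obtain ⟨e₀, i₀⟩ := e 0 h₀ hc₀
  obtain ⟨e₁, i₁⟩ := e 1 h₁ hc₁
  -- The derivative along the boundary integrates to zero over each full line `u⁰ = const`.
  have r₁ : ∫ w in {w : E2 | w 0 ≤ 0}, fderiv ℝ g₁ w (coordVec 1) = 0 := by
    rw [e₁, Measure.volume_eq_prod, setIntegral_prod _ (by rwa [← Measure.volume_eq_prod])]
    refine integral_eq_zero_of_ae (Eventually.of_forall fun a => ?_)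
    simp only [setIntegral_univ, planeEquiv_apply, Pi.zero_apply]
    rw [← integral_deriv_eq_zero_of_hasCompactSupport
      (f := fun t : ℝ => g₁ (a • coordVec 0 + t • coordVec 1)) (by fun_prop)
      (hasCompactSupport_comp_add_smul hc₁ _ _ (coordVec_ne_zero 1))]
    exact integral_congr_ae (Eventually.of_forall fun t => (slice _ _ _ h₁).symm)
  -- Fubini in the swapped order: the inner integral over `u⁰ ≤ 0` is the boundary value at `u⁰ =
  -- 0`.
  have r₀ : ∫ w in {w : E2 | w 0 ≤ 0}, fderiv ℝ g₀ w (coordVec 0) =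
      ∫ t : ℝ, g₀ (t • coordVec 1) := by
    rw [e₀, Measure.volume_eq_prod, ← setIntegral_prod_swap,
      setIntegral_prod (fun z => fderiv ℝ g₀ (planeEquiv z.swap) (coordVec 0)) i₀.swap,
      setIntegral_univ]
    refine integral_congr_ae (Eventually.of_forall fun b => ?_)
    simp only [planeEquiv_apply, Prod.swap]
    have := (hasCompactSupport_comp_add_smul hc₀ (b • coordVec 1) _
      (coordVec_ne_zero 0)).integral_Iic_deriv_eq (by fun_prop) 0
    simp only [zero_smul, add_zero] at this
    rw [← this]
    refine integral_congr_ae (Eventually.of_forall fun t => ?_)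
    simp only [slice _ _ _ h₀, add_comm]
  rw [r₀, r₁, add_zero]

end HalfPlane

/-! ### Boundary charts, the exterior normal, and the contour. -/

section Contour

variable {S P : Set E3} {φ ψ : E2 → E3} {U V : Set E2} {u w : E2}

/-- The transition map preserves `u⁰ ≤ 0` near the point. Hence its first component has a local
maximum along the contour, so zero derivative there, and a nonnegative derivative along `u⁰`.
Injectivity of the differential makes the latter positive, and the change of basis is triangular. -/
theorem IsBoundaryParam.exists_covBasis_eq (hφ : IsBoundaryParam S P φ U)
    (hψ : IsBoundaryParam S P ψ V) (hu : u ∈ U) (hu0 : u 0 = 0) (hw : w ∈ V) (hw0 : w 0 = 0)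
    (huw : φ u = ψ w) :
    LinearMap.range (fderiv ℝ φ u).toLinearMap = LinearMap.range (fderiv ℝ ψ w).toLinearMap ∧
    ∃ a b c : ℝ, 0 < a ∧ covBasis φ 0 u = a • covBasis ψ 0 w + b • covBasis ψ 1 w ∧
      covBasis φ 1 u = c • covBasis ψ 1 w := by
  obtain ⟨τ, hτ, hτu, hev⟩ := hφ.1.exists_transition hψ.1 hu hw huw
  have hd := hψ.1.fderiv_of_transition hw hτ hτu hev
  set A := fderiv ℝ τ u with hA
  have hAi := injective_fderiv_transition (hφ.1.immersion u hu) hd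
  have hsign : ∀ᶠ a in 𝓝 u, a 0 ≤ 0 → τ a 0 ≤ 0 := by
    filter_upwards [hev, hφ.1.isOpen.mem_nhds hu] with a ha haU ha0
    rw [← hψ.2 _ ha.1, ← ha.2, hφ.2 _ haU]
    exact ha0
  have hline : ∀ v, HasDerivAt (fun t : ℝ => τ (u + t • v) 0) (A v 0) 0 := by
    intro v
    have h1 : HasDerivAt (fun t : ℝ => u + t • v) v 0 := by
      simpa using ((hasDerivAt_id (0 : ℝ)).smul_const v).const_add u
    have h2 : HasFDerivAt τ A (u + (0 : ℝ) • v) := by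
      simpa using (hτ.differentiableAt (by simp)).hasFDerivAt
    have h3 := (EuclideanSpace.proj (𝕜 := ℝ) (0 : Fin 2)).hasFDerivAt.comp_hasDerivAt (0 : ℝ)
      (h2.comp_hasDerivAt (0 : ℝ) h1)
    exact h3
  have hsv : ∀ v, ∀ᶠ t : ℝ in 𝓝 0, (u + t • v) 0 ≤ 0 → τ (u + t • v) 0 ≤ 0 := by
    intro v
    have : ContinuousAt (fun t : ℝ => u + t • v) 0 := by fun_prop
    exact this.eventually (by simpa using hsign)
  have h1 : A (coordVec 1) 0 = 0 := by
    refine IsLocalMax.hasDerivAt_eq_zero (f := fun t : ℝ => τ (u + t • coordVec 1) 0) ?_ (hline _)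
    filter_upwards [hsv (coordVec 1)] with t ht
    simpa [hτu, hw0] using ht (by simp [hu0])
  have h0 : 0 ≤ A (coordVec 0) 0 := by
    have h2 := (hline (coordVec 0)).hasDerivWithinAt (s := Iio 0)
    rw [hasDerivWithinAt_iff_tendsto_slope' (by simp)] at h2
    refine ge_of_tendsto h2 ?_
    filter_upwards [nhdsWithin_le_nhds (hsv (coordVec 0)), self_mem_nhdsWithin] with t ht ht0
    have ht0' : t < 0 := ht0
    have := ht (by simpa [hu0] using ht0'.le)
    simp only [slope, zero_smul, add_zero, hτu, hw0, vsub_eq_sub, sub_zero, smul_eq_mul]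
    exact mul_nonneg_of_nonpos_of_nonpos (inv_nonpos.2 ht0'.le) this
  have h0' : A (coordVec 0) 0 ≠ 0 := by
    intro h
    obtain ⟨v, hv⟩ := LinearMap.injective_iff_surjective.1
      (show Function.Injective A.toLinearMap from hAi) (coordVec 0)
    have hv' : A v = coordVec 0 := hv
    have := congrArg (fun v : E2 => v 0) hv'
    rw [eq_sum_coordVec v] at this
    simp [h, h1] at this
  refine ⟨range_fderiv_of_transition (hφ.1.immersion u hu) hd, A (coordVec 0) 0, A (coordVec 0) 1,
    A (coordVec 1) 1, lt_of_le_of_ne h0 h0'.symm, ?_, ?_⟩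
  · conv_lhs => rw [covBasis, hd, ContinuousLinearMap.comp_apply, fderiv_coordVec]
  · conv_lhs => rw [covBasis, hd, ContinuousLinearMap.comp_apply, fderiv_coordVec]
    rw [h1, zero_smul, zero_add]

theorem IsBoundaryParam.isExteriorNormal_iff (hφ : IsBoundaryParam S P φ U) (hu : u ∈ U)
    (hu0 : u 0 = 0) {ν : E3} :
    IsExteriorNormal S P (φ u) ν ↔ ν = ‖conormal φ 0 u‖⁻¹ • conormal φ 0 u := by
  have hJ := hφ.1.areaDensity_pos hu
  have hF0 : 0 < ‖conormal φ 0 u‖ := by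
    rw [hφ.1.norm_conormal_zero hu]
    exact norm_pos_iff.2 (hφ.1.covBasis_ne_zero hu 1)
  constructor
  · rintro ⟨ψ, V, w, hψ, hw, hw0, hwu, hν, ⟨v, hv⟩, hν1, hν0⟩
    obtain ⟨hr, a, b, c, ha, h0, h1⟩ := hφ.exists_covBasis_eq hψ hu hu0 hw hw0 hwu.symm
    have hmem : ν ∈ LinearMap.range (fderiv ℝ φ u).toLinearMap := by
      rw [hr]; exact ⟨v, hv.symm⟩
    have k1 : inner ℝ ν (covBasis φ 1 u) = 0 := by
      rw [h1, inner_smul_right, hν1, mul_zero]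
    have k0 : 0 < inner ℝ ν (covBasis φ 0 u) := by
      rw [h0, inner_add_right, inner_smul_right, inner_smul_right, hν1, mul_zero, add_zero]
      positivity
    -- A tangent vector orthogonal to both `S_0` and `S_1`, hence zero; so `ν` is a positive
    -- multiple of `F⁰`.
    set z := areaDensity φ u • ν - (inner ℝ ν (covBasis φ 0 u) : ℝ) • conormal φ 0 u with hz
    have hzr : z ∈ LinearMap.range (fderiv ℝ φ u).toLinearMap :=
      Submodule.sub_mem _ (Submodule.smul_mem _ _ hmem)
        (Submodule.smul_mem _ _ (conormal_mem_range _ _ _))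
    have hzp : ∀ c, inner ℝ z (covBasis φ c u) = 0 := by
      intro c
      rw [hz, inner_sub_left, inner_smul_left, inner_smul_left, hφ.1.inner_conormal hu]
      fin_cases c
      · simp [mul_comm]
      · simp [k1]
    have hz0 : z = 0 := by
      obtain ⟨t, ht⟩ := hzr
      rw [← inner_self_eq_zero (𝕜 := ℝ)]
      nth_rw 2 [← ht]
      rw [ContinuousLinearMap.coe_coe, fderiv_coordVec, inner_add_right, inner_smul_right,
        inner_smul_right, hzp, hzp]
      simp
    have e1 : areaDensity φ u • ν = (inner ℝ ν (covBasis φ 0 u) : ℝ) • conormal φ 0 u :=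
      sub_eq_zero.1 hz0
    have e2 : areaDensity φ u = inner ℝ ν (covBasis φ 0 u) * ‖conormal φ 0 u‖ := by
      have := congrArg norm e1
      rwa [norm_smul, norm_smul, hν, mul_one, Real.norm_of_nonneg hJ.le,
        Real.norm_of_nonneg k0.le] at this
    rw [e2, mul_smul] at e1
    rw [eq_inv_smul_iff₀ hF0.ne']
    exact smul_right_injective E3 k0.ne' e1
  · rintro rfl
    refine ⟨φ, U, u, hφ, hu, hu0, rfl, ?_, ?_, ?_, ?_⟩
    · rw [norm_smul, norm_inv, norm_norm, inv_mul_cancel₀ hF0.ne']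
    · obtain ⟨v, hv⟩ := Submodule.smul_mem _ ‖conormal φ 0 u‖⁻¹ (conormal_mem_range φ 0 u)
      exact ⟨v, hv.symm⟩
    · rw [inner_smul_left, hφ.1.inner_conormal hu]; simp
    · rw [inner_smul_left, hφ.1.inner_conormal hu]
      simpa using mul_pos (inv_pos.2 hF0) hJ

theorem IsBoundaryParam.exteriorNormal_eq (hφ : IsBoundaryParam S P φ U) (hu : u ∈ U)
    (hu0 : u 0 = 0) :
    exteriorNormal S P (φ u) = ‖conormal φ 0 u‖⁻¹ • conormal φ 0 u :=
  (hφ.isExteriorNormal_iff hu hu0).1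
    (Classical.epsilon_spec ⟨_, (hφ.isExteriorNormal_iff hu hu0).2 rfl⟩)

/-- Points with `u⁰ < 0` have a relative neighbourhood inside `P`; from a point with `u⁰ = 0`, a
small move in the positive `u⁰` direction stays in `S` and leaves `P`. -/
theorem IsBoundaryParam.mem_contour_iff (hφ : IsBoundaryParam S P φ U) (hu : u ∈ U) :
    φ u ∈ contour S P ↔ u 0 = 0 := by
  constructor
  · rintro ⟨hP, hi⟩
    by_contra h0
    have hneg : u 0 < 0 := lt_of_le_of_ne ((hφ.2 u hu).1 hP) h0
    obtain ⟨O, hO, hOW⟩ := hφ.1.open_image (U ∩ {a | a 0 < 0}) inter_subset_left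
      (hφ.1.isOpen.inter (isOpen_lt (by fun_prop) continuous_const))
    refine hi ⟨hP, O, hO, (hOW.subset (mem_image_of_mem φ ⟨hu, hneg⟩)).2, ?_⟩
    rw [← hOW]
    rintro _ ⟨a, ha, rfl⟩
    exact (hφ.2 a ha.1).2 (le_of_lt ha.2)
  · intro h0
    refine ⟨(hφ.2 u hu).2 h0.le, ?_⟩
    rintro ⟨-, O, hO, hxO, hOP⟩
    have hc : ∀ᶠ a in 𝓝 u, φ a ∈ O ∧ a ∈ U :=
      ((hφ.1.differentiableAt hu).continuousAt.eventually (hO.mem_nhds hxO)).and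
        (hφ.1.isOpen.mem_nhds hu)
    have hl : ContinuousAt (fun t : ℝ => u + t • coordVec 0) 0 := by fun_prop
    have h2 : ∀ᶠ t : ℝ in 𝓝[>] 0, φ (u + t • coordVec 0) ∈ O ∧ u + t • coordVec 0 ∈ U :=
      nhdsWithin_le_nhds (hl.eventually (p := fun a => φ a ∈ O ∧ a ∈ U)
        (by simpa only [zero_smul, add_zero] using hc))
    obtain ⟨t, ⟨ht, htU⟩, ht0⟩ := (h2.and self_mem_nhdsWithin).exists
    have := (hφ.2 _ htU).1 (hOP ⟨hφ.1.mapsTo htU, ht⟩)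
    simp [h0] at this
    exact absurd ht0 (not_lt.2 this)

theorem IsBoundaryParam.mono {W : Set E2} (hφ : IsBoundaryParam S P φ U) (hW : IsOpen W)
    (hWU : W ⊆ U) : IsBoundaryParam S P φ W :=
  ⟨hφ.1.mono hW hWU, fun w hw => hφ.2 w (hWU hw)⟩

/-- Allows interior and contour points to be treated alike: near an interior point, a chart
translated into `u⁰ < 0` satisfies the boundary condition trivially. -/
theorem IsRegularPatch.exists_boundaryParam (hS : IsSmoothSurface S) (hP : IsRegularPatch S P)
    {x : E3} (hx : x ∈ P) :
    ∃ (φ : E2 → E3) (U : Set E2) (u : E2), IsBoundaryParam S P φ U ∧ u ∈ U ∧ φ u = x := by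
  by_cases hi : x ∈ interiorIn S P
  · obtain ⟨-, O, hO, hxO, hOP⟩ := hi
    obtain ⟨φ, U, u, hφ, hu, rfl⟩ := hS x (hP.subset hx)
    -- After the cut at `u 0 + 1` and the translation by the same amount, the chart domain lies in
    -- `u⁰ < 0` and the point has first coordinate `-1`.
    have hW : IsOpen (U ∩ φ ⁻¹' O ∩ {w | w 0 < u 0 + 1}) :=
      (hφ.smooth.continuousOn.isOpen_inter_preimage hφ.isOpen hO).inter
        (isOpen_lt (by fun_prop) continuous_const)
    have h1 := (hφ.mono hW (inter_subset_left.trans inter_subset_left)).translate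
      ((u 0 + 1) • coordVec 0)
    refine ⟨_, _, u - (u 0 + 1) • coordVec 0, ⟨h1, ?_⟩, ?_, ?_⟩
    · intro w hw
      have hneg : w 0 ≤ 0 := by
        have : (w + (u 0 + 1) • coordVec 0) 0 < u 0 + 1 := hw.2
        simp at this
        linarith
      exact ⟨fun _ => hneg, fun _ => hOP ⟨hφ.mapsTo hw.1.1, hw.1.2⟩⟩
    · simp [hu, hxO]
    · simp
  · obtain ⟨φ, U, u, hφ, hu, -, h⟩ := hP.smooth_contour x ⟨hx, hi⟩
    exact ⟨φ, U, u, hφ, hu, h⟩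

theorem IsRegularPatch.existsUnique_exteriorNormal (hP : IsRegularPatch S P) {x : E3}
    (hx : x ∈ contour S P) : ∃! ν, IsExteriorNormal S P x ν := by
  obtain ⟨φ, U, u, hφ, hu, hu0, rfl⟩ := hP.smooth_contour x hx
  exact ⟨_, (hφ.isExteriorNormal_iff hu hu0).2 rfl, fun ν hν =>
    (hφ.isExteriorNormal_iff hu hu0).1 hν⟩

theorem IsRegularPatch.isClosed_contour (hP : IsRegularPatch S P) : IsClosed (contour S P) := by
  have : contour S P = P \ ⋃₀ {O | IsOpen O ∧ S ∩ O ⊆ P} := by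
    ext x
    constructor
    · rintro ⟨hx, hi⟩
      refine ⟨hx, ?_⟩
      rintro ⟨O, ⟨hO, hOP⟩, hxO⟩
      exact hi ⟨hx, O, hO, hxO, hOP⟩
    · rintro ⟨hx, hi⟩
      refine ⟨hx, ?_⟩
      rintro ⟨-, O, hO, hxO, hOP⟩
      exact hi ⟨O, ⟨hO, hOP⟩, hxO⟩
  rw [this]
  exact hP.isCompact.isClosed.sdiff (isOpen_sUnion fun O hO => hO.1)

end Contour

/-! ### Integration in a boundary chart and the localized integral formula. -/

section LocalStokes

variable {S P O : Set E3} {φ : E2 → E3} {U : Set E2} {u : E2} {r : ℝ}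
  {G : Type*} [NormedAddCommGroup G] [NormedSpace ℝ G]

theorem IsLocalParam.contDiffOn_one (h : IsLocalParam S φ U) : ContDiffOn ℝ 1 φ U :=
  h.smooth.of_le (by exact_mod_cast le_top)

theorem IsLocalParam.integral_image (h : IsLocalParam S φ U) {s : Set E2} (hs : s ⊆ U)
    (hm : MeasurableSet s) (g : E3 → G) :
    ∫ x in φ '' s, g x ∂μHE[2] = ∫ w in s, areaDensity φ w • g (φ w) := by
  have := integral_image_eq_integral_normDet_fderiv_smul h.isOpen h.contDiffOn_one h.immersion
    h.injOn hs hm g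
  rwa [finrank_euclideanSpace_fin] at this

theorem IsLocalParam.integrableOn_image (h : IsLocalParam S φ U) {s : Set E2} (hs : s ⊆ U)
    (hm : MeasurableSet s) (g : E3 → G) :
    IntegrableOn g (φ '' s) μHE[2] ↔ IntegrableOn (fun w => areaDensity φ w • g (φ w)) s := by
  have := integrableOn_image_iff_integrableOn_normDet_fderiv_smul h.isOpen h.contDiffOn_one
    h.immersion h.injOn hs hm g
  rwa [finrank_euclideanSpace_fin] at this

theorem IsLocalParam.measure_image (h : IsLocalParam S φ U) {s : Set E2} (hs : s ⊆ U)
    (hm : MeasurableSet s) :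
    μHE[2] (φ '' s) = ∫⁻ w in s, ENNReal.ofReal (areaDensity φ w) := by
  have := euclideanHausdorffMeasure_image_eq_lintegral h.isOpen h.contDiffOn_one h.immersion
    h.injOn hs hm
  rwa [finrank_euclideanSpace_fin] at this

theorem normDet_real (L : ℝ →L[ℝ] E3) : L.toLinearMap.normDet = ‖L 1‖ := by
  have h := L.toLinearMap.normDet_sq_eq_det_gram (OrthonormalBasis.singleton (Fin 1) ℝ)
  rw [Matrix.det_unique] at h
  simp only [Matrix.gram_apply, OrthonormalBasis.singleton_apply, ContinuousLinearMap.coe_coe,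
    real_inner_self_eq_norm_sq] at h
  exact (sq_eq_sq₀ (LinearMap.normDet_nonneg _) (norm_nonneg _)).1 h

theorem IsLocalParam.hasFDerivAt_coordLine (h : IsLocalParam S φ U) {t : ℝ}
    (ht : t • coordVec 1 ∈ U) :
    HasFDerivAt (fun t : ℝ => φ (t • coordVec 1))
      ((fderiv ℝ φ (t • coordVec 1)).comp ((1 : ℝ →L[ℝ] ℝ).smulRight (coordVec 1))) t := by
  have h1 : HasFDerivAt (fun t : ℝ => t • coordVec 1) ((1 : ℝ →L[ℝ] ℝ).smulRight (coordVec 1)) t :=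
    ((1 : ℝ →L[ℝ] ℝ).smulRight (coordVec 1)).hasFDerivAt
  exact HasFDerivAt.comp t (h.differentiableAt ht).hasFDerivAt h1

theorem IsLocalParam.integral_image_coordLine (h : IsLocalParam S φ U) {s : Set ℝ}
    (hs : s ⊆ {t | t • coordVec 1 ∈ U}) (hm : MeasurableSet s) (g : E3 → G) :
    (∫ x in (fun t : ℝ => φ (t • coordVec 1)) '' s, g x ∂μHE[1] =
      ∫ t in s, ‖covBasis φ 1 (t • coordVec 1)‖ • g (φ (t • coordVec 1))) ∧
    (IntegrableOn g ((fun t : ℝ => φ (t • coordVec 1)) '' s) μHE[1] ↔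
      IntegrableOn (fun t => ‖covBasis φ 1 (t • coordVec 1)‖ • g (φ (t • coordVec 1))) s) := by
  have hl : ContDiff ℝ 1 fun t : ℝ => t • coordVec 1 := by fun_prop
  have hU : IsOpen {t : ℝ | t • coordVec 1 ∈ U} := h.isOpen.preimage hl.continuous
  have hf : ContDiffOn ℝ 1 (fun t : ℝ => φ (t • coordVec 1)) {t : ℝ | t • coordVec 1 ∈ U} :=
    h.contDiffOn_one.comp hl.contDiffOn fun t ht => ht
  have hi : ∀ t ∈ {t : ℝ | t • coordVec 1 ∈ U},
      Function.Injective (fderiv ℝ (fun t : ℝ => φ (t • coordVec 1)) t) := by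
    intro t ht
    rw [(h.hasFDerivAt_coordLine ht).fderiv]
    refine (h.immersion _ ht).comp fun a b hab => ?_
    exact smul_left_injective ℝ (coordVec_ne_zero 1) (by simpa using hab)
  have hinj : InjOn (fun t : ℝ => φ (t • coordVec 1)) {t : ℝ | t • coordVec 1 ∈ U} :=
    fun a ha b hb hab => smul_left_injective ℝ (coordVec_ne_zero 1) (h.injOn ha hb hab)
  have hJ : ∀ t ∈ s, (fderiv ℝ (fun t : ℝ => φ (t • coordVec 1)) t).toLinearMap.normDet =
      ‖covBasis φ 1 (t • coordVec 1)‖ := by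
    intro t ht
    rw [normDet_real, (h.hasFDerivAt_coordLine (hs ht)).fderiv]
    simp [covBasis]
  have h1 := integral_image_eq_integral_normDet_fderiv_smul hU hf hi hinj hs hm g
  have h2 := integrableOn_image_iff_integrableOn_normDet_fderiv_smul hU hf hi hinj hs hm g
  rw [Module.finrank_self] at h1 h2
  refine ⟨h1.trans (setIntegral_congr_fun hm fun t ht => ?_),
    h2.trans (integrableOn_congr_fun (fun t ht => ?_) hm)⟩ <;> simp only [hJ t ht]

/-- The closed ball inside `U` supplies the compactness for integrability; the open ball has an
image cut out of `S` by an open set. -/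
theorem IsLocalParam.exists_ball (h : IsLocalParam S φ U) (hu : u ∈ U) :
    ∃ r > 0, Metric.closedBall u r ⊆ U ∧
      ∃ O : Set E3, IsOpen O ∧ φ u ∈ O ∧ φ '' Metric.ball u r = S ∩ O := by
  obtain ⟨r, hr, hrU⟩ := Metric.nhds_basis_closedBall.mem_iff.1 (h.isOpen.mem_nhds hu)
  obtain ⟨O, hO, hOW⟩ := h.open_image _ (Metric.ball_subset_closedBall.trans hrU)
    Metric.isOpen_ball
  exact ⟨r, hr, hrU, O, hO,
    (hOW.subset (mem_image_of_mem φ (Metric.mem_ball_self hr))).2, hOW⟩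

theorem IsBoundaryParam.inter_eq (hφ : IsBoundaryParam S P φ U) (hPS : P ⊆ S)
    (hr : Metric.closedBall u r ⊆ U) (hO : φ '' Metric.ball u r = S ∩ O) :
    P ∩ O = φ '' (Metric.ball u r ∩ {w | w 0 ≤ 0}) := by
  ext x
  constructor
  · rintro ⟨hxP, hxO⟩
    obtain ⟨w, hw, rfl⟩ := hO.symm.subset ⟨hPS hxP, hxO⟩
    exact ⟨w, ⟨hw, (hφ.2 w (hr (Metric.ball_subset_closedBall hw))).1 hxP⟩, rfl⟩
  · rintro ⟨w, hw, rfl⟩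
    exact ⟨(hφ.2 w (hr (Metric.ball_subset_closedBall hw.1))).2 hw.2,
      (hO.subset (mem_image_of_mem φ hw.1)).2⟩

theorem IsBoundaryParam.contour_inter_eq (hφ : IsBoundaryParam S P φ U) (hPS : P ⊆ S)
    (hr : Metric.closedBall u r ⊆ U) (hO : φ '' Metric.ball u r = S ∩ O) :
    contour S P ∩ O =
      (fun t : ℝ => φ (t • coordVec 1)) '' {t | t • coordVec 1 ∈ Metric.ball u r} := by
  ext x
  constructor
  · rintro ⟨hxP, hxO⟩
    obtain ⟨w, hw, rfl⟩ := hO.symm.subset ⟨hPS hxP.1, hxO⟩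
    have h0 := (hφ.mem_contour_iff (hr (Metric.ball_subset_closedBall hw))).1 hxP
    have hw1 : w 1 • coordVec 1 = w := by
      conv_rhs => rw [eq_sum_coordVec w, h0, zero_smul, zero_add]
    exact ⟨w 1, by rwa [mem_ofPred_eq, hw1], congrArg φ hw1⟩
  · rintro ⟨t, ht, rfl⟩
    exact ⟨(hφ.mem_contour_iff (hr (Metric.ball_subset_closedBall ht))).2 (by simp),
      (hO.subset (mem_image_of_mem φ ht)).2⟩

theorem measurableSet_halfPlane : MeasurableSet {w : E2 | w 0 ≤ 0} :=
  (isClosed_le (by fun_prop) continuous_const).measurableSet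

theorem IsBoundaryParam.measure_inter_lt_top (hφ : IsBoundaryParam S P φ U) (hPS : P ⊆ S)
    (hr : Metric.closedBall u r ⊆ U) (hO : φ '' Metric.ball u r = S ∩ O) :
    μHE[2] (P ∩ O) < ⊤ := by
  have hsub : Metric.ball u r ∩ {w | w 0 ≤ 0} ⊆ Metric.closedBall u r :=
    inter_subset_left.trans Metric.ball_subset_closedBall
  have hi : IntegrableOn (areaDensity φ) (Metric.closedBall u r) :=
    ContinuousOn.integrableOn_compact (isCompact_closedBall u r) fun w hw =>
      (hφ.1.contDiffAt_areaDensity (hr hw)).continuousAt.continuousWithinAt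
  have h1 : IntegrableOn (fun _ => (1 : ℝ)) (P ∩ O) μHE[2] := by
    rw [hφ.inter_eq hPS hr hO, hφ.1.integrableOn_image (hsub.trans hr)
      (Metric.isOpen_ball.measurableSet.inter measurableSet_halfPlane)]
    simpa using hi.mono_set hsub
  simpa [integrableOn_const_iff] using h1

theorem IsBoundaryParam.measure_inter_pos (hφ : IsBoundaryParam S P φ U) (hPS : P ⊆ S)
    (hu0 : u 0 ≤ 0) (hr0 : 0 < r)
    (hr : Metric.closedBall u r ⊆ U) (hO : φ '' Metric.ball u r = S ∩ O) :
    0 < μHE[2] (P ∩ O) := by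
  set W := Metric.ball u r ∩ {w : E2 | w 0 < 0} with hW
  have hWo : IsOpen W := Metric.isOpen_ball.inter (isOpen_lt (by fun_prop) continuous_const)
  have hWU : W ⊆ U := inter_subset_left.trans (Metric.ball_subset_closedBall.trans hr)
  have hsub : φ '' W ⊆ P ∩ O := by
    rw [hφ.inter_eq hPS hr hO]
    exact image_mono (inter_subset_inter_right _ fun w (hw : w 0 < 0) => hw.le)
  refine lt_of_lt_of_le ?_ (measure_mono hsub)
  rw [hφ.1.measure_image hWU hWo.measurableSet, setLIntegral_pos_iff
    (show Measurable fun w => ENNReal.ofReal (areaDensity φ w) from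
      measurable_normDet_fderiv.ennreal_ofReal)]
  have hsupp : (Function.support fun w => ENNReal.ofReal (areaDensity φ w)) ∩ W = W := by
    refine inter_eq_right.2 fun w hw => ?_
    simpa using hφ.1.areaDensity_pos (hWU hw)
  rw [hsupp]
  -- Since `u 0 ≤ 0`, a shift by `r / 2` in the negative `u⁰` direction lands in the open half ball,
  -- even from the contour.
  refine hWo.measure_pos _ ⟨u - (r / 2) • coordVec 0, ?_, ?_⟩
  · have hn : ‖coordVec 0‖ = 1 := by simp [coordVec]
    rw [mem_ball_iff_norm', sub_sub_cancel, norm_smul, hn, Real.norm_of_nonneg (by positivity)]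
    linarith
  · simp only [mem_ofPred_eq, PiLp.sub_apply, PiLp.smul_apply, coordVec_zero_zero]
    simp
    linarith

theorem IsBoundaryParam.norm_smul_exteriorNormal (hφ : IsBoundaryParam S P φ U) {t : ℝ}
    (ht : t • coordVec 1 ∈ U) : ‖covBasis φ 1 (t • coordVec 1)‖ •
      exteriorNormal S P (φ (t • coordVec 1)) = conormal φ 0 (t • coordVec 1) := by
  rw [hφ.exteriorNormal_eq ht (by simp), hφ.1.norm_conormal_zero ht, smul_smul,
    mul_inv_cancel₀ (norm_ne_zero_iff.2 (hφ.1.covBasis_ne_zero ht 1)), one_smul]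

theorem isCompact_preimage_coordLine {K : Set E2} (hK : IsCompact K) :
    IsCompact {t : ℝ | t • coordVec 1 ∈ K} :=
  (isClosedEmbedding_smul_left (coordVec_ne_zero 1)).isCompact_preimage hK

theorem measurableSet_preimage_coordLine {s : Set E2} (hs : IsOpen s) :
    MeasurableSet {t : ℝ | t • coordVec 1 ∈ s} :=
  (hs.preimage (f := fun t : ℝ => t • coordVec 1) (by fun_prop)).measurableSet

theorem IsBoundaryParam.integrableOn_exteriorNormal (hφ : IsBoundaryParam S P φ U) (hPS : P ⊆ S)
    (hr : Metric.closedBall u r ⊆ U) (hO : φ '' Metric.ball u r = S ∩ O) :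
    IntegrableOn (exteriorNormal S P) (contour S P ∩ O) μHE[1] := by
  have hm := measurableSet_preimage_coordLine (Metric.isOpen_ball (x := u) (ε := r))
  have hsub : {t : ℝ | t • coordVec 1 ∈ Metric.ball u r} ⊆
      {t : ℝ | t • coordVec 1 ∈ Metric.closedBall u r} := fun t ht =>
    Metric.ball_subset_closedBall ht
  have hi : IntegrableOn (fun t : ℝ => conormal φ 0 (t • coordVec 1))
      {t : ℝ | t • coordVec 1 ∈ Metric.closedBall u r} :=
    ContinuousOn.integrableOn_compact (isCompact_preimage_coordLine (isCompact_closedBall u r))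
      fun t ht => ContinuousAt.continuousWithinAt (ContinuousAt.comp (g := conormal φ 0)
        (hφ.1.contDiffAt_conormal (hr ht) 0).continuousAt
        (f := fun t : ℝ => t • coordVec 1) (by fun_prop))
  rw [hφ.contour_inter_eq hPS hr hO,
    (hφ.1.integral_image_coordLine (fun t ht => hr (hsub ht)) hm _).2]
  refine (hi.mono_set hsub).congr_fun (fun t ht => ?_) hm
  exact (hφ.norm_smul_exteriorNormal (hr (hsub ht))).symm

theorem stokesDensity_eq_zero {χ : E3 → ℝ} {x : E3} (hx : x ∉ tsupport χ) :
    stokesDensity S χ x = 0 := by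
  have h := notMem_tsupport_iff_eventuallyEq.1 hx
  rw [stokesDensity, gradient, h.fderiv_eq, h.self_of_nhds]
  simp

/-- The integral formula for a patch, localized to a coordinate ball by a cutoff function. -/
theorem IsBoundaryParam.local_stokes (hφ : IsBoundaryParam S P φ U) (hP : IsRegularPatch S P)
    (hr : Metric.closedBall u r ⊆ U) (hO : φ '' Metric.ball u r = S ∩ O)
    {χ : E3 → ℝ} (hχ : ContDiff ℝ 1 χ) (hχO : tsupport χ ⊆ O) :
    IntegrableOn (stokesDensity S χ) P μHE[2] ∧
      ∫ x in contour S P, χ x • exteriorNormal S P x ∂μHE[1] =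
        ∫ x in P, stokesDensity S χ x ∂μHE[2] := by
  have hPS := hP.subset
  have hbU : Metric.ball u r ⊆ U := Metric.ball_subset_closedBall.trans hr
  set K : Set E2 := Metric.closedBall u r ∩ φ ⁻¹' tsupport χ with hK
  have hKc : IsCompact K := by
    refine (isCompact_closedBall u r).of_isClosed_subset ?_ inter_subset_left
    exact (hφ.1.smooth.continuousOn.mono hr).preimage_isClosed_of_isClosed
      Metric.isClosed_closedBall (isClosed_tsupport χ)
  have hKb : K ⊆ Metric.ball u r := by
    -- `K` is taken in the closed ball to be compact. It avoids the sphere because `χ` is supported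
    -- in `O`, whose trace on `S` is the image of the open ball, and `φ` is injective.
    rintro w ⟨hw, hwχ⟩
    obtain ⟨b, hb, hbw⟩ := hO.symm.subset ⟨hφ.1.mapsTo (hr hw), hχO hwχ⟩
    rwa [← hφ.1.injOn (hbU hb) (hr hw) hbw]
  -- Extension by zero of `χ F^a` to the plane; it is C¹ because it vanishes off the compact set `K`
  -- inside the ball.
  set g : Fin 2 → E2 → E3 := fun a =>
    (Metric.ball u r).indicator fun w => χ (φ w) • conormal φ a w with hg
  have hgK : ∀ a, ∀ w ∉ K, g a w = 0 := by
    intro a w hw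
    by_cases hwb : w ∈ Metric.ball u r
    · have : φ w ∉ tsupport χ := fun h => hw ⟨Metric.ball_subset_closedBall hwb, h⟩
      simp [hg, hwb, image_eq_zero_of_notMem_tsupport this]
    · simp [hg, hwb]
  have hgc : ∀ a, HasCompactSupport (g a) := fun a => HasCompactSupport.intro hKc (hgK a)
  have hgb : ∀ a, ∀ w ∈ Metric.ball u r, g a =ᶠ[𝓝 w] fun w => χ (φ w) • conormal φ a w :=
    fun a w hw => (eqOn_indicator).eventuallyEq_of_mem (Metric.isOpen_ball.mem_nhds hw)
  have hg0 : ∀ a, ∀ w ∉ K, g a =ᶠ[𝓝 w] fun _ => 0 := fun a w hw => by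
    filter_upwards [hKc.isClosed.isOpen_compl.mem_nhds hw] with y hy using hgK a y hy
  have hgs : ∀ a, ContDiff ℝ 1 (g a) := by
    intro a
    rw [contDiff_iff_contDiffAt]
    intro w
    by_cases hw : w ∈ K
    · refine ContDiffAt.congr_of_eventuallyEq ?_ (hgb a w (hKb hw))
      have hwU := hbU (hKb hw)
      exact (hχ.contDiffAt.comp w ((hφ.1.contDiffAt hwU).of_le (by exact_mod_cast le_top))).smul
        (hφ.1.contDiffAt_conormal hwU a)
    · exact ContDiffAt.congr_of_eventuallyEq contDiffAt_const (hg0 a w hw)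
  have hdiv := integral_halfPlane_div (hgs 0) (hgs 1) (hgc 0) (hgc 1)
  set D : E2 → E3 := fun w => fderiv ℝ (g 0) w (coordVec 0) + fderiv ℝ (g 1) w (coordVec 1) with hD
  have hDb : ∀ w ∈ Metric.ball u r, D w = areaDensity φ w • stokesDensity S χ (φ w) := by
    intro w hw
    rw [← hφ.1.div_smul_conormal (hbU hw) (hχ.differentiable one_ne_zero _)]
    simp only [hD]
    rw [(hgb 0 w hw).fderiv_eq, (hgb 1 w hw).fderiv_eq]
  have hD0 : ∀ w ∉ Metric.ball u r, D w = 0 := by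
    intro w hw
    have hw' : w ∉ K := fun h => hw (hKb h)
    simp only [hD]
    rw [(hg0 0 w hw').fderiv_eq, (hg0 1 w hw').fderiv_eq]
    simp
  have hDi : Integrable D := by
    refine Integrable.add ?_ ?_
    · exact (((hgs 0).continuous_fderiv one_ne_zero).clm_apply
        continuous_const).integrable_of_hasCompactSupport ((hgc 0).fderiv_apply ℝ _)
    · exact (((hgs 1).continuous_fderiv one_ne_zero).clm_apply
        continuous_const).integrable_of_hasCompactSupport ((hgc 1).fderiv_apply ℝ _)
  have hm := (Metric.isOpen_ball (x := u) (ε := r)).measurableSet.inter measurableSet_halfPlane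
  have hbU' : Metric.ball u r ∩ {w | w 0 ≤ 0} ⊆ U := inter_subset_left.trans hbU
  have hoff : ∀ x ∈ P \ (P ∩ O), stokesDensity S χ x = 0 := fun x hx =>
    stokesDensity_eq_zero fun h => hx.2 ⟨hx.1, hχO h⟩
  have hPi : IntegrableOn (stokesDensity S χ) (P ∩ O) μHE[2] := by
    rw [hφ.inter_eq hPS hr hO, hφ.1.integrableOn_image hbU' hm]
    exact hDi.integrableOn.congr_fun (fun w hw => hDb w hw.1) hm
  refine ⟨hPi.of_forall_sdiff_eq_zero hP.isCompact.measurableSet hoff, ?_⟩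
  have e1 : ∫ x in P, stokesDensity S χ x ∂μHE[2] = ∫ t : ℝ, g 0 (t • coordVec 1) := by
    rw [setIntegral_eq_of_subset_of_forall_sdiff_eq_zero hP.isCompact.measurableSet
      inter_subset_left hoff, hφ.inter_eq hPS hr hO, hφ.1.integral_image hbU' hm, ← hdiv,
      setIntegral_eq_of_subset_of_forall_sdiff_eq_zero measurableSet_halfPlane
      (inter_subset_right (s := Metric.ball u r)) fun w hw => hD0 w fun h => hw.2 ⟨h, hw.1⟩]
    exact setIntegral_congr_fun hm fun w hw => (hDb w hw.1).symm
  have hmI := measurableSet_preimage_coordLine (Metric.isOpen_ball (x := u) (ε := r))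
  have e2 : ∫ x in contour S P, χ x • exteriorNormal S P x ∂μHE[1] =
      ∫ t : ℝ, g 0 (t • coordVec 1) := by
    rw [setIntegral_eq_of_subset_of_forall_sdiff_eq_zero hP.isClosed_contour.measurableSet
      (inter_subset_left (t := O)) fun x hx => by
        rw [image_eq_zero_of_notMem_tsupport fun h => hx.2 ⟨hx.1, hχO h⟩, zero_smul],
      hφ.contour_inter_eq hPS hr hO,
      (hφ.1.integral_image_coordLine
        (s := {t | t • coordVec 1 ∈ Metric.ball u r}) (fun t ht => hbU ht) hmI _).1,
      ← setIntegral_univ (μ := volume),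
      setIntegral_eq_of_subset_of_forall_sdiff_eq_zero (f := fun t : ℝ => g 0 (t • coordVec 1))
      MeasurableSet.univ (subset_univ {t : ℝ | t • coordVec 1 ∈ Metric.ball u r}) fun t ht =>
        hgK 0 _ fun h => ht.2 (hKb h)]
    refine setIntegral_congr_fun hmI fun t ht => ?_
    have ht' : t • coordVec 1 ∈ Metric.ball u r := ht
    simp only [hg, indicator_of_mem ht']
    rw [smul_comm, hφ.norm_smul_exteriorNormal (hbU ht')]
  rw [e1, e2]

end LocalStokes

/-! ### Gluing, continuity of the mean curvature vector, and the limit. -/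

section GlobalStokes

variable {S P : Set E3}

open scoped Manifold in
/-- Smooth functions subordinate to a finite open cover of a compact set, with sum one near it. -/
theorem exists_finite_partition {ι : Type*} [Finite ι] {K : Set E3} (hK : IsCompact K)
    {O : ι → Set E3} (hO : ∀ i, IsOpen (O i)) (hKO : K ⊆ ⋃ i, O i) :
    ∃ χ : ι → E3 → ℝ, (∀ i, ContDiff ℝ ∞ (χ i)) ∧ (∀ i, tsupport (χ i) ⊆ O i) ∧
      ∀ x ∈ K, ∑ᶠ i, χ i =ᶠ[𝓝 x] fun _ => 1 := by
  -- The partition is built on a larger compact set, so that the sum is 1 near each point of `K` and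
  -- can be differentiated there.
  obtain ⟨L, hL, hKL, hLO⟩ := exists_compact_between hK (isOpen_iUnion hO) hKO
  obtain ⟨f, hf⟩ := SmoothPartitionOfUnity.exists_isSubordinate 𝓘(ℝ, E3) hL.isClosed O hO hLO
  refine ⟨fun i => f i, fun i => (f i).contMDiff.contDiff, hf, fun x hx => ?_⟩
  filter_upwards [isOpen_interior.mem_nhds (hKL hx)] with y hy
  have := f.sum_eq_one (interior_subset hy)
  rw [finsum_apply (Set.toFinite _)]
  exact this

theorem IsRegularPatch.exists_cover (hS : IsSmoothSurface S) (hP : IsRegularPatch S P) {x : E3}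
    (hx : x ∈ P) : ∃ O : Set E3, IsOpen O ∧ x ∈ O ∧ 0 < μHE[2] (P ∩ O) ∧ μHE[2] (P ∩ O) < ⊤ ∧
      IntegrableOn (exteriorNormal S P) (contour S P ∩ O) μHE[1] ∧
      ∀ χ : E3 → ℝ, ContDiff ℝ 1 χ → tsupport χ ⊆ O →
        IntegrableOn (stokesDensity S χ) P μHE[2] ∧
        ∫ x in contour S P, χ x • exteriorNormal S P x ∂μHE[1] =
          ∫ x in P, stokesDensity S χ x ∂μHE[2] := by
  obtain ⟨φ, U, u, hφ, hu, rfl⟩ := hP.exists_boundaryParam hS hx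
  obtain ⟨r, hr0, hr, O, hO, hxO, hOe⟩ := hφ.1.exists_ball hu
  exact ⟨O, hO, hxO, hφ.measure_inter_pos hP.subset ((hφ.2 u hu).1 hx) hr0 hr hOe,
    hφ.measure_inter_lt_top hP.subset hr hOe, hφ.integrableOn_exteriorNormal hP.subset hr hOe,
    fun χ h1 h2 => hφ.local_stokes hP hr hOe h1 h2⟩

theorem IsRegularPatch.measure_pos (hS : IsSmoothSurface S) (hP : IsRegularPatch S P) :
    0 < μHE[2] P := by
  obtain ⟨x, hx⟩ := hP.nonempty
  obtain ⟨O, -, -, h, -⟩ := hP.exists_cover hS hx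
  exact h.trans_le (measure_mono inter_subset_left)

/-- Every regular patch has finite area, an integrable exterior normal, and the integral of the
exterior normal over its contour is the integral of the mean curvature vector over the patch. -/
theorem IsRegularPatch.stokes (hS : IsSmoothSurface S) (hP : IsRegularPatch S P) :
    μHE[2] P < ⊤ ∧ IntegrableOn (exteriorNormal S P) (contour S P) μHE[1] ∧
      IntegrableOn (meanCurvatureVector S) P μHE[2] ∧
      normalIntegral S P = ∫ x in P, meanCurvatureVector S x ∂μHE[2] := by
  choose! O hO hxO _ hfin hint hst using fun x (hx : x ∈ P) => hP.exists_cover hS hx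
  obtain ⟨t, ht⟩ := hP.isCompact.elim_finite_subcover (fun x : P => O x) (fun x => hO x x.2)
    fun x hx => mem_iUnion.2 ⟨⟨x, hx⟩, hxO x hx⟩
  have hsub : P ⊆ ⋃ i : t, O (i : P) := fun x hx => by
    obtain ⟨i, hi, hxi⟩ := mem_iUnion₂.1 (ht hx)
    exact mem_iUnion.2 ⟨⟨i, hi⟩, hxi⟩
  have hP1 : P = ⋃ i : t, P ∩ O (i : P) := by
    rw [← inter_iUnion]; exact (inter_eq_left.2 hsub).symm
  have hC1 : contour S P = ⋃ i : t, contour S P ∩ O (i : P) := by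
    rw [← inter_iUnion]; exact (inter_eq_left.2 (sdiff_subset.trans hsub)).symm
  have hn : IntegrableOn (exteriorNormal S P) (contour S P) μHE[1] := by
    rw [hC1]
    exact integrableOn_finite_iUnion.2 fun i => hint _ i.1.2
  obtain ⟨χ, hχ, hχO, hχ1⟩ := exists_finite_partition hP.isCompact
    (fun i : t => hO (i : P) i.1.2) hsub
  have hχ' : ∀ i, ContDiff ℝ 1 (χ i) := fun i => (hχ i).of_le (by exact_mod_cast le_top)
  have hloc := fun i : t => hst _ i.1.2 (χ i) (hχ' i) (hχO i)
  -- The cutoffs sum to 1 near each point of `P`, so their gradients sum to 0 and the densities sum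
  -- to `H`.
  have hsum : ∀ x ∈ P, ∑ i, χ i x = 1 ∧ ∑ i, gradient (χ i) x = 0 := by
    intro x hx
    have h1 : ∑ i, χ i =ᶠ[𝓝 x] fun _ => 1 := by
      rw [← finsum_eq_sum_of_fintype]; exact hχ1 x hx
    refine ⟨by simpa using h1.self_of_nhds, ?_⟩
    simp only [gradient]
    rw [← map_sum, ← fderiv_sum fun i _ => (hχ' i).differentiable one_ne_zero x, h1.fderiv_eq]
    simp
  have hdens : ∀ x ∈ P, ∑ i, stokesDensity S (χ i) x = meanCurvatureVector S x := by
    intro x hx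
    simp only [stokesDensity]
    rw [Finset.sum_add_distrib, ← Finset.sum_smul, ← map_sum, (hsum x hx).1, (hsum x hx).2]
    simp
  have hPm := hP.isCompact.measurableSet
  refine ⟨?_, hn, ?_, ?_⟩
  · rw [hP1]
    exact (measure_iUnion_le _).trans_lt (by
      rw [tsum_fintype]
      exact ENNReal.sum_lt_top.2 fun i _ => hfin _ i.1.2)
  · exact IntegrableOn.congr_fun (integrable_finsetSum _ fun i _ => (hloc i).1) hdens hPm
  · have hχn : ∀ i, IntegrableOn (fun x => χ i x • exteriorNormal S P x) (contour S P) μHE[1] := by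
      intro i
      exact hn.continuousOn_smul (hχ' i).continuous.continuousOn
        (hP.isCompact.of_isClosed_subset hP.isClosed_contour sdiff_subset)
    calc normalIntegral S P
        = ∫ x in contour S P, ∑ i, χ i x • exteriorNormal S P x ∂μHE[1] := by
          refine setIntegral_congr_fun hP.isClosed_contour.measurableSet fun x hx => ?_
          rw [← Finset.sum_smul, (hsum x hx.1).1, one_smul]
      _ = ∑ i, ∫ x in contour S P, χ i x • exteriorNormal S P x ∂μHE[1] :=
          integral_finsetSum _ fun i _ => hχn i
      _ = ∑ i, ∫ x in P, stokesDensity S (χ i) x ∂μHE[2] :=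
          Finset.sum_congr rfl fun i _ => (hloc i).2
      _ = ∫ x in P, ∑ i, stokesDensity S (χ i) x ∂μHE[2] :=
          (integral_finsetSum _ fun i _ => (hloc i).1).symm
      _ = _ := setIntegral_congr_fun hPm hdens

/-- By `div_conormal`, `H` is `J⁻¹` times a divergence of C¹ fields; no continuous choice of normal
is needed. -/
theorem IsLocalParam.continuousAt_meanCurvatureVector {φ : E2 → E3} {U : Set E2} {u : E2}
    (h : IsLocalParam S φ U) (hu : u ∈ U) :
    ContinuousAt (fun w => meanCurvatureVector S (φ w)) u := by
  have hc : ∀ a, ContinuousAt (fun w => fderiv ℝ (conormal φ a) w (coordVec a)) u := fun a =>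
    (((h.contDiffAt_conormal hu a).fderiv_right (m := 0) (by simp)).continuousAt).clm_apply
      continuousAt_const
  have hJ := (h.contDiffAt_areaDensity hu).continuousAt.inv₀ (h.areaDensity_pos hu).ne'
  refine (hJ.smul ((hc 0).add (hc 1))).congr ?_
  filter_upwards [h.isOpen.mem_nhds hu] with w hw
  simp only [Pi.smul_apply', Pi.add_apply, Pi.inv_apply]
  rw [h.div_conormal hw, smul_smul, inv_mul_cancel₀ (h.areaDensity_pos hw).ne', one_smul]

/-- By `stokes` the quotient is the mean of `H` over the patch, so it is as close to `H(φ u)` as the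
values of `H` on the patch are. -/
theorem tendsto_normalIntegral (hS : IsSmoothSurface S) {φ : E2 → E3} {U : Set E2} {u : E2}
    (h : IsLocalParam S φ U) (hu : u ∈ U) :
    Tendsto (fun P => (1 / area P) • normalIntegral S P) (shrinkingPatches S (φ u))
      (𝓝 (meanCurvatureVector S (φ u))) := by
  rw [Metric.tendsto_nhds]
  intro ε hε
  obtain ⟨W, hWs, hWo, huW⟩ := eventually_nhds_iff.1 (((Metric.tendsto_nhds.1
    (h.continuousAt_meanCurvatureVector hu)) (ε / 2) (half_pos hε)).and (h.isOpen.mem_nhds hu))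
  obtain ⟨O, hO, hOW⟩ := h.open_image W (fun w hw => (hWs w hw).2) hWo
  have hxO : φ u ∈ O := (hOW.subset (mem_image_of_mem φ huW)).2
  have h1 : ∀ᶠ P in shrinkingPatches S (φ u), P ⊆ O ∧ IsRegularPatch S P :=
    ((eventually_smallSets_subset.2 (hO.mem_nhds hxO)).filter_mono inf_le_left).and
      ((eventually_principal.2 fun _ h => h).filter_mono inf_le_right)
  filter_upwards [h1] with P hPO
  obtain ⟨hPO, hP⟩ := hPO
  obtain ⟨hfin, -, hi, hst⟩ := hP.stokes hS
  have hA : 0 < area P := ENNReal.toReal_pos (hP.measure_pos hS).ne' hfin.ne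
  have hb : ∀ x ∈ P, ‖meanCurvatureVector S x - meanCurvatureVector S (φ u)‖ ≤ ε / 2 := by
    intro x hx
    obtain ⟨w, hw, rfl⟩ := hOW.symm.subset ⟨hP.subset hx, hPO hx⟩
    rw [← dist_eq_norm]
    exact (hWs w hw).1.le
  have e : (1 / area P) • normalIntegral S P - meanCurvatureVector S (φ u) =
      (1 / area P) • ∫ x in P, (meanCurvatureVector S x - meanCurvatureVector S (φ u)) ∂μHE[2] := by
    rw [integral_sub hi (integrableOn_const hfin.ne), setIntegral_const, hst, smul_sub, smul_smul]
    congr 1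
    change _ = (1 / area P * area P) • _
    rw [one_div_mul_cancel hA.ne', one_smul]
  rw [dist_eq_norm, e, norm_smul, Real.norm_of_nonneg (by positivity)]
  have hn := norm_setIntegral_le_of_norm_le_const hfin hb
  calc 1 / area P * _ ≤ 1 / area P * (ε / 2 * area P) := by gcongr; exact hn
    _ = ε / 2 := by field_simp
    _ < ε := half_lt_self hε

theorem IsMinimalSurface.meanCurvatureVector_eq_zero (hS : IsMinimalSurface S) {x : E3}
    (hx : x ∈ S) : meanCurvatureVector S x = 0 := by
  obtain ⟨φ, U, u, hφ, hu, rfl⟩ := hS.1 x hx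
  obtain ⟨N, hN⟩ := exists_isUnitNormal (hφ.immersion u hu)
  rw [hφ.meanCurvatureVector_eq hu hN, hS.2 φ U hφ u hu N hN, zero_smul]

end GlobalStokes

end SurfacePatch

theorem mainTheorem2 (S : Set SurfacePatch.E3) (hS : SurfacePatch.IsSmoothSurface S) :
    -- areas and contour integrals of patches are well defined
    (∀ P : Set SurfacePatch.E3, SurfacePatch.IsRegularPatch S P →
      0 < μHE[2] P ∧ μHE[2] P < ⊤ ∧
        (∀ x ∈ SurfacePatch.contour S P, ∃! ν, SurfacePatch.IsExteriorNormal S P x ν) ∧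
        IntegrableOn (SurfacePatch.exteriorNormal S P) (SurfacePatch.contour S P) μHE[1]) ∧
    -- the mean curvature vector as a limit over patches that shrink to a point
    (∀ (φ : SurfacePatch.E2 → SurfacePatch.E3) (U : Set SurfacePatch.E2) (u : SurfacePatch.E2)
        (N : SurfacePatch.E3),
      SurfacePatch.IsLocalParam S φ U → u ∈ U → SurfacePatch.IsUnitNormal φ u N →
        Tendsto (fun P => (1 / SurfacePatch.area P) • SurfacePatch.normalIntegral S P)
          (SurfacePatch.shrinkingPatches S (φ u))
          (𝓝 (SurfacePatch.meanCurvature φ u N • N))) ∧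
    -- contours of patches in minimal surfaces
    (SurfacePatch.IsMinimalSurface S → ∀ P : Set SurfacePatch.E3,
      SurfacePatch.IsRegularPatch S P → SurfacePatch.normalIntegral S P = 0) := by
  refine ⟨fun P hP => ⟨hP.measure_pos hS, (hP.stokes hS).1,
    fun x hx => hP.existsUnique_exteriorNormal hx, (hP.stokes hS).2.1⟩, ?_, ?_⟩
  · intro φ U u N hφ hu hN
    rw [← hφ.meanCurvatureVector_eq hu hN]
    exact SurfacePatch.tendsto_normalIntegral hS hφ hu
  · intro hmin P hP
    rw [(hP.stokes hS).2.2.2]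
    exact setIntegral_eq_zero_of_forall_eq_zero fun x hx =>
      hmin.meanCurvatureVector_eq_zero (hP.subset hx)
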